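/- Let $d\ge 1$, $\alpha\ge 1$ and $K>0$. There are constants $C_0>0$ and $C_{snr}>0$, depending only on $d,\alpha,K$, such that the following holds. Setting: Let $\mathcal O\subset\mathbb R$ be measurable, with Lebesgue measure. For every sample size $N$ let $A^*=A^*_N\in L_2(\mathcal O^d)$ be the target, with $\|A^*_N\|_{L_2}=O(1)$, and let $\widehat A=\widehat A_N$ be a random linear functional $G\mapsto\langle\widehat A,G\rangle$ on $L_2(\mathcal O^d)$; write $\widehat A[u_1,\dots,u_d]=\langle \widehat A,u_1\otimes\cdots\otimes u_d\rangle$. Let $\phi_1,\phi_2,\dots$ be orthonormal in $L_2(\mathcal O)$, let $m,\ell_1,\dots,\ell_d\in\mathbb N$, and put $\mathcal M_j=\mathrm{span}\{\phi_\mu(z_j)\}_{\mu=1}^m$, $\mathcal L_j=\mathrm{span}\{\prod_{i\ne j}\phi_{\eta_i}(z_i)\}_{\eta_i=1,\ i\neq j}^{\ell_j}$. The targets, estimators, ranks, singular values, $\phi_k$, $m$, $\ell_j$ and the probability spaces may depend on $N$; all asymptotic relations are for $N\to\infty$, and $X_N=O_{\mathbb P}(a_N)$ means that for every $\epsilon>0$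 there is $K_\epsilon>0$ with $\limsup_N\mathbb P(|X_N/a_N|\ge K_\epsilon)<\epsilon$. For each $j$ let $x=z_j$ and $y=(z_i)_{i\ne j}$, let $\mathcal P_{\mathcal M},\mathcal P_{\mathcal L}$ be orthogonal projections, and let $(T\times_x\mathcal P_{\mathcal M}\times_y\mathcal P_{\mathcal L})[u,v]=T[\mathcal P_{\mathcal M}u,\mathcal P_{\mathcal L}v]$ and $\|T\|_{op}=\sup_{\|u\|,\|v\|\le1}T[u,v]$. Algorithm: For each $j$ let $\widehat\Phi_{j,1},\dots,\widehat\Phi_{j,r_j}\in\mathcal M_j$ be leading $r_j$ left singular functions (in the variable $z_j$) of $\widehat A\times_x\mathcal P_{\mathcal M_j}\times_y\mathcal P_{\mathcal L_j}$ (any choice if they are not unique) and $\widehat{\mathcal P}_j=\sum_{\rho}\widehat\Phi_{j,\rho}\otimes\widehat\Phi_{j,\rho}$. The output is $\widehat A\times_1\widehat{\mathcal P}_1\cdots\times_d\widehat{\mathcal P}_d=\sum_{\rho_1=1}^{r_1}\cdots\sum_{\rho_d=1}^{r_d}\widehat A[\widehat\Phi_{1,\rho_1},\dots,\widehat\Phi_{d,\rho_d}]\;\widehat\Phi_{1,\rho_1}\otimes\cdots\otimes\widehat\Phi_{d,\rho_d}$.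 Assumptions: (1) For each $j$, $A^*(z)=\sum_{\rho=1}^{r_j}\sigma_{j,\rho}\Phi^*_{j,\rho}(z_j)\Psi^*_{j,\rho}((z_i)_{i\ne j})$ with $r_j\ge1$, $\sigma_{j,1}\ge\cdots\ge\sigma_{j,r_j}>0$ and orthonormal systems $\{\Phi^*_{j,\rho}\}_\rho\subset L_2(\mathcal O)$, $\{\Psi^*_{j,\rho}\}_\rho\subset L_2(\mathcal O^{d-1})$. (2) $\mathbb E\langle\widehat A,G\rangle=\langle A^*,G\rangle$ for all nonrandom $G\in L_2(\mathcal O^d)$, and $\sup_{\|G\|\le1}\mathrm{Var}\langle\widehat A,G\rangle=O(1/N)$. (3) For each $j$ and all large $N$, with $\mathcal M=\mathcal M_j$, $\mathcal L=\mathcal L_j$, $\ell=\ell_j$: $\|A^*-A^*\times_x\mathcal P_{\mathcal M}\times_y\mathcal P_{\mathcal L}\|_{L_2}^2\le K(m^{-2\alpha}+\ell^{-2\alpha})$, $\|A^*-A^*\times_y\mathcal P_{\mathcal L}\|_{L_2}^2\le K\ell^{-2\alpha}$, and $\|A^*\times_y\mathcal P_{\mathcal L}-A^*\times_x\mathcal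 P_{\mathcal M}\times_y\mathcal P_{\mathcal L}\|_{L_2}^2\le Km^{-2\alpha}$. (4) For each $j$, $\|(\widehat A-A^*)\times_x\mathcal P_{\mathcal M_j}\times_y\mathcal P_{\mathcal L_j}\|_{op}=O_{\mathbb P}\big(\sqrt{(m+\ell_j^{d-1})/N}\big)$. (5) With $\sigma_{\min}=\min_j\sigma_{j,r_j}$, for all large $N$, $N^{2\alpha/(2\alpha+1)}>C_{snr}\max\{\prod_{j=1}^dr_j,\ \sigma_{\min}^{-((d-1)/\alpha+2)},\ \sigma_{\min}^{-2\alpha/(\alpha-1/2)}\}$. (6) $C_L\sigma_{j,r_j}^{-1/\alpha}\le\ell_j\le C_L'\sigma_{j,r_j}^{-1/\alpha}$ for all $j$ and large $N$, with constants $C_L\ge C_0$ and $C_L'$; moreover $m\asymp N^{1/(2\alpha+1)}$. Conclusion: $\|\widehat A\times_1\widehat{\mathcal P}_1\cdots\times_d\widehat{\mathcal P}_d-A^*\|^2_{L_2(\mathcal O^d)}=O_{\mathbb P}\Big(\frac{\sum_{j=1}^d\sigma_{j,r_j}^{-2}}{N^{2\alpha/(2\alpha+1)}}+\frac{\sum_{j=1}^d\sigma_{j,r_j}^{-(d-1)/\alpha-2}}{N}+\frac{\prod_{j=1}^dr_j}{N}\Big)$.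 -/

import Mathlib

open MeasureTheory ProbabilityTheory Filter Topology

noncomputable section

namespace VRS

universe u

/-! ## Function spaces and tensor products of functions -/

/-- `L₂(O^ι)` with respect to Lebesgue measure, for `O ⊆ ℝ` and a finite set of variables `ι`. -/
abbrev L2 (O : Set ℝ) (ι : Type) [Fintype ι] : Type :=
  Lp ℝ 2 (Measure.pi fun _ : ι => (volume : Measure ℝ).restrict O)

/-- `L₂(O)`, functions of one variable. -/
abbrev L2one (O : Set ℝ) : Type := Lp ℝ 2 ((volume : Measure ℝ).restrict O)

/-- All the variables except the `j`-th one. -/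
abbrev Others {ι : Type} (j : ι) : Type := {i : ι // ¬ i = j}

lemma memLp_pureTensor {O : Set ℝ} {ι : Type} [Fintype ι] (f : ι → L2one O) :
    MemLp (fun z : ι → ℝ => ∏ i, f i (z i)) 2
      (Measure.pi fun _ : ι => (volume : Measure ℝ).restrict O) := by
  have hm : AEStronglyMeasurable (fun z : ι → ℝ => ∏ i, f i (z i))
      (Measure.pi fun _ : ι => (volume : Measure ℝ).restrict O) :=
    Finset.aestronglyMeasurable_fun_prod _ fun i _ =>
      (Lp.aestronglyMeasurable (f i)).comp_quasiMeasurePreserving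
        (Measure.quasiMeasurePreserving_eval _ i)
  rw [memLp_two_iff_integrable_sq hm]
  simp_rw [← Finset.prod_pow]
  exact Integrable.fintype_prod (f := fun i x => (f i x) ^ 2) fun i => (Lp.memLp (f i)).integrable_sq

/-- The product function `z ↦ ∏ i, f i (z i)` in `L₂(O^ι)`. -/
def pureTensor {O : Set ℝ} {ι : Type} [Fintype ι] (f : ι → L2one O) : L2 O ι :=
  (memLp_pureTensor f).toLp _

/-- Splitting `z` into its `j`-th coordinate and the remaining ones. -/
def split {ι : Type} (j : ι) (z : ι → ℝ) : ℝ × (Others j → ℝ) := (z j, fun i => z i)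

lemma measurePreserving_split (O : Set ℝ) {ι : Type} [Fintype ι] [DecidableEq ι] (j : ι) :
    MeasurePreserving (split j) (Measure.pi fun _ : ι => (volume : Measure ℝ).restrict O)
      (((volume : Measure ℝ).restrict O).prod
        (Measure.pi fun _ : Others j => (volume : Measure ℝ).restrict O)) := by
  have h1 := measurePreserving_piEquivPiSubtypeProd
    (fun _ : ι => (volume : Measure ℝ).restrict O) (fun i => i = j)
  let _ : Fintype {i : ι // i = j} := Subtype.fintype _
  have h2 : MeasurePreserving (MeasurableEquiv.funUnique {i : ι // i = j} ℝ)
      (Measure.pi fun _ : {i : ι // i = j} => (volume : Measure ℝ).restrict O)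
      ((volume : Measure ℝ).restrict O) := by
    convert measurePreserving_funUnique ((volume : Measure ℝ).restrict O) {i : ι // i = j}
    rfl
  have h3 := (h2.prod (MeasurePreserving.id
    (Measure.pi fun _ : Others j => (volume : Measure ℝ).restrict O)))
  exact h3.comp h1

lemma memLp_tensorFun {O : Set ℝ} {ι : Type} [Fintype ι] [DecidableEq ι] (j : ι)
    (f : L2one O) (g : L2 O (Others j)) :
    MemLp (fun z : ι → ℝ => f (split j z).1 * g (split j z).2) 2
      (Measure.pi fun _ : ι => (volume : Measure ℝ).restrict O) := by
  have hm : AEStronglyMeasurable (fun p : ℝ × (Others j → ℝ) => f p.1 * g p.2)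
      (((volume : Measure ℝ).restrict O).prod
        (Measure.pi fun _ : Others j => (volume : Measure ℝ).restrict O)) :=
    (Lp.aestronglyMeasurable f).comp_fst.mul (Lp.aestronglyMeasurable g).comp_snd
  have h : MemLp (fun p : ℝ × (Others j → ℝ) => f p.1 * g p.2) 2
      (((volume : Measure ℝ).restrict O).prod
        (Measure.pi fun _ : Others j => (volume : Measure ℝ).restrict O)) := by
    rw [memLp_two_iff_integrable_sq hm]
    simp_rw [mul_pow]
    exact (Lp.memLp f).integrable_sq.mul_prod (Lp.memLp g).integrable_sq
  exact h.comp_measurePreserving (measurePreserving_split O j)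

/-- The function `z ↦ f (z_j) * g (z_1, …, z_{j-1}, z_{j+1}, …, z_d)` in `L₂(O^ι)`. -/
def tensorFun {O : Set ℝ} {ι : Type} [Fintype ι] [DecidableEq ι] (j : ι)
    (f : L2one O) (g : L2 O (Others j)) : L2 O ι :=
  (memLp_tensorFun j f g).toLp _

lemma coeFn_tensorFun {O : Set ℝ} {ι : Type} [Fintype ι] [DecidableEq ι] (j : ι)
    (f : L2one O) (g : L2 O (Others j)) :
    tensorFun j f g =ᵐ[Measure.pi fun _ : ι => (volume : Measure ℝ).restrict O]
      fun z => f (split j z).1 * g (split j z).2 :=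
  MemLp.coeFn_toLp _

lemma norm_sq_L2 {X : Type*} [MeasurableSpace X] {μ : Measure X} (f : Lp ℝ 2 μ) :
    ‖f‖ ^ 2 = ∫ x, (f x) ^ 2 ∂μ := by
  rw [← real_inner_self_eq_norm_sq, L2.inner_def]
  exact integral_congr_ae (ae_of_all _ fun x => by simp [pow_two])

lemma norm_tensorFun {O : Set ℝ} {ι : Type} [Fintype ι] [DecidableEq ι] (j : ι)
    (f : L2one O) (g : L2 O (Others j)) : ‖tensorFun j f g‖ = ‖f‖ * ‖g‖ := by
  have h : ‖tensorFun j f g‖ ^ 2 = (‖f‖ * ‖g‖) ^ 2 := by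
    rw [mul_pow, norm_sq_L2, norm_sq_L2 f, norm_sq_L2 g, ← integral_prod_mul,
      ← (measurePreserving_split O j).map_eq,
      integral_map (measurePreserving_split O j).measurable.aemeasurable]
    · refine integral_congr_ae ((coeFn_tensorFun j f g).mono fun z hz => ?_)
      simp only [hz, mul_pow]
    · rw [(measurePreserving_split O j).map_eq]
      exact ((Lp.aestronglyMeasurable f).pow 2).comp_fst.mul
        ((Lp.aestronglyMeasurable g).pow 2).comp_snd
  exact (sq_eq_sq₀ (norm_nonneg _) (by positivity)).1 h

/-- `(f, g) ↦ f ⊗_j g` as a bounded bilinear map, where `(f ⊗_j g)(z) = f (z_j) g (z_{-j})`. -/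
def tensorAt {O : Set ℝ} {ι : Type} [Fintype ι] [DecidableEq ι] (j : ι) :
    L2one O →L[ℝ] L2 O (Others j) →L[ℝ] L2 O ι :=
  LinearMap.mkContinuous₂
    (LinearMap.mk₂ ℝ (tensorFun j)
      (fun f f' g => by
        have q := (Measure.quasiMeasurePreserving_fst.comp
          (measurePreserving_split O j).quasiMeasurePreserving)
        refine Lp.ext ?_
        filter_upwards [coeFn_tensorFun j (f + f') g, coeFn_tensorFun j f g,
          coeFn_tensorFun j f' g, Lp.coeFn_add (tensorFun j f g) (tensorFun j f' g),
          q.ae (Lp.coeFn_add f f')] with z h1 h2 h3 h4 h5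
        simp only [Function.comp_apply] at h5
        rw [h1, h4, Pi.add_apply, h2, h3, h5, Pi.add_apply, add_mul])
      (fun c f g => by
        have q := (Measure.quasiMeasurePreserving_fst.comp
          (measurePreserving_split O j).quasiMeasurePreserving)
        refine Lp.ext ?_
        filter_upwards [coeFn_tensorFun j (c • f) g, coeFn_tensorFun j f g,
          Lp.coeFn_smul c (tensorFun j f g), q.ae (Lp.coeFn_smul c f)] with z h1 h2 h4 h5
        simp only [Function.comp_apply] at h5
        rw [h1, h4, Pi.smul_apply, h2, h5, Pi.smul_apply, smul_eq_mul, smul_eq_mul, mul_assoc])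
      (fun f g g' => by
        have q := (Measure.quasiMeasurePreserving_snd.comp
          (measurePreserving_split O j).quasiMeasurePreserving)
        refine Lp.ext ?_
        filter_upwards [coeFn_tensorFun j f (g + g'), coeFn_tensorFun j f g,
          coeFn_tensorFun j f g', Lp.coeFn_add (tensorFun j f g) (tensorFun j f g'),
          q.ae (Lp.coeFn_add g g')] with z h1 h2 h3 h4 h5
        simp only [Function.comp_apply] at h5
        rw [h1, h4, Pi.add_apply, h2, h3, h5, Pi.add_apply, mul_add])
      (fun c f g => by
        have q := (Measure.quasiMeasurePreserving_snd.comp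
          (measurePreserving_split O j).quasiMeasurePreserving)
        refine Lp.ext ?_
        filter_upwards [coeFn_tensorFun j f (c • g), coeFn_tensorFun j f g,
          Lp.coeFn_smul c (tensorFun j f g), q.ae (Lp.coeFn_smul c g)] with z h1 h2 h4 h5
        simp only [Function.comp_apply] at h5
        rw [h1, h4, Pi.smul_apply, h2, h5, Pi.smul_apply, smul_eq_mul, smul_eq_mul]
        ring)) 1
    (fun f g => by simp [norm_tensorFun])

/-! ## Projections and mode products -/

/-- The orthogonal projection `f ↦ ∑ₖ ⟨f, eₖ⟩ eₖ` onto the span of a finite orthonormal family. -/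
def proj {H : Type*} [NormedAddCommGroup H] [InnerProductSpace ℝ H] {κ : Type*} [Fintype κ]
    (e : κ → H) (f : H) : H := ∑ k, inner ℝ f (e k) • e k

/-- The partial integral `z_j ↦ ∫ A(z_j, y) w(y) dy` of `A` against a function `w` of the other
variables: the element of `L₂(O)` with `⟨contract j w A, u⟩ = ⟨A, u ⊗_j w⟩` for all `u`. -/
def contract {O : Set ℝ} {ι : Type} [Fintype ι] [DecidableEq ι] (j : ι)
    (w : L2 O (Others j)) (A : L2 O ι) : L2one O :=
  ContinuousLinearMap.adjoint ((tensorAt (O := O) j).flip w) A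

/-- `A ×_y P_L`, where `y` is the group of all variables except the `j`-th and `L` is spanned by
the orthonormal family `w`: the function `∑_η (∫ A(·, y) w_η(y) dy) ⊗ w_η`. -/
def projOthers {O : Set ℝ} {ι : Type} [Fintype ι] [DecidableEq ι] (j : ι) {κ : Type*} [Fintype κ]
    (w : κ → L2 O (Others j)) (A : L2 O ι) : L2 O ι :=
  ∑ η, tensorAt j (contract j (w η) A) (w η)

/-- `T ×_x P_M ×_y P_L` for a linear functional `T` on `L₂(O^ι)` (written `G ↦ ⟨T, G⟩`), where `x`
is the `j`-th variable, `y` the others, and `M`, `L` are spanned by the orthonormal families `v`,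
`w`: the function `∑_{μ, η} T[v_μ, w_η] v_μ ⊗ w_η`. -/
def projBoth {O : Set ℝ} {ι : Type} [Fintype ι] [DecidableEq ι] (j : ι) {κ κ' : Type*}
    [Fintype κ] [Fintype κ'] (v : κ → L2one O) (w : κ' → L2 O (Others j))
    (T : L2 O ι →ₗ[ℝ] ℝ) : L2 O ι :=
  ∑ μ, ∑ η, T (tensorAt j (v μ) (w η)) • tensorAt j (v μ) (w η)

/-- The functional `G ↦ ⟨A, G⟩` given by a function `A`. -/
def functional {O : Set ℝ} {ι : Type} [Fintype ι] (A : L2 O ι) : L2 O ι →ₗ[ℝ] ℝ :=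
  (innerSL ℝ A).toLinearMap

/-- The operator norm of `T ×_x P_M ×_y P_L`, that is the supremum of `T[P_M u, P_L v]` over
`‖u‖ ≤ 1`, `‖v‖ ≤ 1`. -/
def opNormProj {O : Set ℝ} {ι : Type} [Fintype ι] [DecidableEq ι] (j : ι) {κ κ' : Type*}
    [Fintype κ] [Fintype κ'] (v : κ → L2one O) (w : κ' → L2 O (Others j))
    (T : L2 O ι →ₗ[ℝ] ℝ) : ℝ :=
  sSup {t : ℝ | ∃ (f : L2one O) (g : L2 O (Others j)), ‖f‖ ≤ 1 ∧ ‖g‖ ≤ 1 ∧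
    t = T (tensorAt j (proj v f) (proj w g))}

/-! ## Stochastic order -/

/-- `X_N = O_ℙ(a_N)`, where `X_N` lives on a probability space that may depend on `N`.  (`a_N` is
eventually positive wherever this is used, so that `K a_N ≤ |X_N|` says `|X_N / a_N| ≥ K`.) -/
def IsBigOP {Ω : ℕ → Type u} [∀ N, MeasurableSpace (Ω N)] (P : ∀ N, Measure (Ω N))
    (X : ∀ N, Ω N → ℝ) (a : ℕ → ℝ) : Prop :=
  ∀ ε : ℝ, 0 < ε → ∃ K : ℝ, 0 < K ∧
    limsup (fun N => P N {ω | K * a N ≤ |X N ω|}) atTop < ENNReal.ofReal ε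

/-! ## The estimation and sketching spaces -/

/-- The basis `φ_1, …, φ_m` of the estimation space `M_j` (the sequence `φ` is indexed from 0). -/
def estBasis {O : Set ℝ} (φ : ℕ → L2one O) (m : ℕ) : Fin m → L2one O := fun μ => φ μ

/-- The basis of the sketching space `L_j`: all products `∏_{i ≠ j} φ_{η_i}(z_i)` with
`1 ≤ η_i ≤ l`. -/
def sketchBasis {O : Set ℝ} {ι : Type} [Fintype ι] [DecidableEq ι] (φ : ℕ → L2one O) (j : ι)
    (l : ℕ) : (Others j → Fin l) → L2 O (Others j) := fun η => pureTensor fun i => φ (η i)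

/-! ## The algorithm -/

/-- `Φ` is a choice of the leading `r` singular functions, in the `j`-th variable, of the function
`A`, taken within the space `M`: the first `r` left singular functions in some singular value
decomposition of `A` with nonincreasing nonnegative singular values.  (Left singular functions
with nonzero singular value lie in `M` automatically when `A ∈ M ⊗ L`.) -/
def IsLeadingSingularFunctions {O : Set ℝ} {ι : Type} [Fintype ι] [DecidableEq ι] (j : ι)
    (M : Submodule ℝ (L2one O)) (A : L2 O ι) {r : ℕ} (Φ : Fin r → L2one O) : Prop :=
  ∃ (q : ℕ) (hrq : r ≤ q) (s : Fin q → ℝ) (U : Fin q → L2one O) (V : Fin q → L2 O (Others j)),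
    Antitone s ∧ (∀ ρ, 0 ≤ s ρ) ∧ Orthonormal ℝ U ∧ Orthonormal ℝ V ∧ (∀ ρ, U ρ ∈ M) ∧
    A = ∑ ρ, s ρ • tensorAt j (U ρ) (V ρ) ∧
    ∀ ρ : Fin r, Φ ρ = U (Fin.castLE hrq ρ)

/-- `Φ` is an output of range estimation by sketching in the `j`-th variable: the leading `r`
singular functions of the sketched and projected estimator `Â ×_x P_M ×_y P_L`. -/
def IsRangeEstimate {O : Set ℝ} {ι : Type} [Fintype ι] [DecidableEq ι] (T : L2 O ι →ₗ[ℝ] ℝ)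
    (φ : ℕ → L2one O) (m l : ℕ) (j : ι) {r : ℕ} (Φ : Fin r → L2one O) : Prop :=
  IsLeadingSingularFunctions j (Submodule.span ℝ (Set.range (estBasis φ m)))
    (projBoth j (estBasis φ m) (sketchBasis φ j l) T) Φ

/-- The final estimate `Â ×_1 P̂_1 ⋯ ×_d P̂_d`, namely
`∑_{ρ_1, …, ρ_d} Â[Φ_{1,ρ_1}, …, Φ_{d,ρ_d}] Φ_{1,ρ_1} ⊗ ⋯ ⊗ Φ_{d,ρ_d}`. -/
def finalEstimate {O : Set ℝ} {ι : Type} [Fintype ι] [DecidableEq ι] (T : L2 O ι →ₗ[ℝ] ℝ)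
    {r : ι → ℕ} (Φ : ∀ i, Fin (r i) → L2one O) : L2 O ι :=
  ∑ ρ : (∀ i, Fin (r i)), T (pureTensor fun i => Φ i (ρ i)) • pureTensor fun i => Φ i (ρ i)

/-! ## Assumptions -/

/-- In the `j`-th variable, `A` has a finite singular value decomposition
`A(z) = ∑_{ρ=1}^r σ_ρ Φ_ρ(z_j) Ψ_ρ(z_{-j})` with `σ_1 ≥ ⋯ ≥ σ_r > 0`, `r ≥ 1`. -/
def HasModeSVD {O : Set ℝ} {ι : Type} [Fintype ι] [DecidableEq ι] (j : ι) (A : L2 O ι)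
    (r : ℕ) (σ : ℕ → ℝ) : Prop :=
  1 ≤ r ∧ (∀ ρ, 1 ≤ ρ → ρ ≤ r → 0 < σ ρ) ∧
    (∀ ρ ρ', 1 ≤ ρ → ρ ≤ ρ' → ρ' ≤ r → σ ρ' ≤ σ ρ) ∧
    ∃ (Φ : Fin r → L2one O) (Ψ : Fin r → L2 O (Others j)), Orthonormal ℝ Φ ∧ Orthonormal ℝ Ψ ∧
      A = ∑ ρ : Fin r, σ (ρ + 1) • tensorAt j (Φ ρ) (Ψ ρ)

/-- The random functional `Â` (given by the random variables `⟨Â, G⟩`) is unbiased for `A`, and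
the variances of `⟨Â, G⟩`, `‖G‖ ≤ 1`, exist and are at most `v`. -/
def IsUnbiasedWithVariance {O : Set ℝ} {ι : Type} [Fintype ι] {Ω : Type u}
    [MeasurableSpace Ω] (P : Measure Ω) (Ahat : Ω → L2 O ι →ₗ[ℝ] ℝ) (A : L2 O ι) (v : ℝ) : Prop :=
  (∀ G : L2 O ι, MemLp (fun ω => Ahat ω G) 2 P) ∧
  (∀ G : L2 O ι, ∫ ω, Ahat ω G ∂P = inner ℝ A G) ∧
  ∀ G : L2 O ι, ‖G‖ ≤ 1 → variance (fun ω => Ahat ω G) P ≤ v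

/-- The three bias bounds, with constant `K` and smoothness `α`, for the pair `(M_j, L_j)`. -/
def BiasBounds {O : Set ℝ} {ι : Type} [Fintype ι] [DecidableEq ι] (K α : ℝ) (φ : ℕ → L2one O)
    (m l : ℕ) (j : ι) (A : L2 O ι) : Prop :=
  ‖A - projBoth j (estBasis φ m) (sketchBasis φ j l) (functional A)‖ ^ 2
      ≤ K * ((m : ℝ) ^ (-2 * α) + (l : ℝ) ^ (-2 * α)) ∧
  ‖A - projOthers j (sketchBasis φ j l) A‖ ^ 2 ≤ K * (l : ℝ) ^ (-2 * α) ∧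
  ‖projOthers j (sketchBasis φ j l) A -
      projBoth j (estBasis φ m) (sketchBasis φ j l) (functional A)‖ ^ 2
      ≤ K * (m : ℝ) ^ (-2 * α)

end VRS

end

open VRS

/-!
Write `Z = Â - A` for the noise and `Π` for the product of the estimated projections in the `d`
variables.  The error splits as `Z ×_1 P̂_1 ⋯ ×_d P̂_d - (A - Π A)`.

*Range estimation* (`norm_sub_proj_range_le`).  The sketch `A ×_y P_L` is only required to have the
same range as `A` in the variable `z_j`.  The lower bound on `C_L` makes the sketching bias at most
half of the smallest singular value `s`, so every `x` in the true range is the image under the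
sketched operator of some `h` with `‖h‖ ≤ (2 / s) ‖x‖`.  Applying the estimation bias `η` and the
operator norm `ε` of the projected noise to `h`, and Eckart--Young to the discarded singular values,
gives `‖x - P̂ x‖ ≤ δ ‖x‖` with `δ = (2 / s) (η + 2 ε)`.  The two ranges have the same dimension,
so the same `δ` bounds the distance of the estimated range to the true one
(`norm_sub_proj_le_of_swap`).

*Approximation error* (`norm_sub_finalEstimate_functional_le`).  `Π A` is the best approximation of
`A` in the span of the products of estimated singular functions, and the composition of the mode
projections maps into that span, as one checks on products of functions, which are total in `L₂`
(`dense_span_pureTensor`).  Hence `‖A - Π A‖ ≤ ∑ δ_j ‖A‖`.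

*Noise* (`norm_sq_finalEstimate_le`).  The projections depend on the noise.  The estimated singular
functions are expanded in a nonrandom dictionary, consisting of the `r_j` true singular functions,
projected to the estimation space, and of the `m` basis functions of that space.  The coefficients
with respect to the latter carry a factor `δ_j`, so that `‖Z ×_1 P̂_1 ⋯ ×_d P̂_d‖²` is at most `2 ^ d`
times a nonrandom quadratic form in `Z`, whose mean is at most `(Kv / N) ∏ (r_j + m δ_j²)`.  The
signal-to-noise condition implies that `m δ_j²` is bounded (`mul_rangeRate_le`), and Markov's
inequality concludes.
-/

namespace VRS

/-! ### Projections onto finite orthonormal families -/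

section Hilbert

variable {H : Type*} [NormedAddCommGroup H] [InnerProductSpace ℝ H]
variable {κ : Type*} [Fintype κ]

lemma norm_sq_sum_orthonormal {e : κ → H} (he : Orthonormal ℝ e) (c : κ → ℝ) :
    ‖∑ k, c k • e k‖ ^ 2 = ∑ k, c k ^ 2 := by
  rw [← real_inner_self_eq_norm_sq, he.inner_sum]
  simp [pow_two]

lemma inner_sum_orthonormal {e : κ → H} (he : Orthonormal ℝ e) (c : κ → ℝ) (k : κ) :
    inner ℝ (∑ i, c i • e i) (e k) = c k := by
  classical
  rw [he.inner_left_sum c (Finset.mem_univ k)]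
  simp

lemma norm_sq_proj {e : κ → H} (he : Orthonormal ℝ e) (f : H) :
    ‖proj e f‖ ^ 2 = ∑ k, inner ℝ f (e k) ^ 2 :=
  norm_sq_sum_orthonormal he _

lemma inner_proj_left (e : κ → H) (f g : H) : inner ℝ (proj e f) g = inner ℝ f (proj e g) := by
  simp only [proj, sum_inner, inner_sum, inner_smul_left, inner_smul_right]
  refine Finset.sum_congr rfl fun k _ => ?_
  simp [real_inner_comm, mul_comm]

lemma proj_mem (e : κ → H) (f : H) : proj e f ∈ Submodule.span ℝ (Set.range e) :=
  Submodule.sum_mem _ fun k _ => Submodule.smul_mem _ _ (Submodule.subset_span ⟨k, rfl⟩)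

lemma proj_add (e : κ → H) (f g : H) : proj e (f + g) = proj e f + proj e g := by
  simp [proj, inner_add_left, add_smul, Finset.sum_add_distrib]

lemma proj_smul (e : κ → H) (c : ℝ) (f : H) : proj e (c • f) = c • proj e f := by
  simp [proj, inner_smul_left, mul_smul, Finset.smul_sum]

lemma proj_sum_smul {e : κ → H} (he : Orthonormal ℝ e) (c : κ → ℝ) :
    proj e (∑ k, c k • e k) = ∑ k, c k • e k := by
  simp [proj, inner_sum_orthonormal he]

lemma exists_eq_sum_of_mem_span {e : κ → H} {f : H} (hf : f ∈ Submodule.span ℝ (Set.range e)) :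
    ∃ c : κ → ℝ, f = ∑ k, c k • e k := by
  obtain ⟨c, hc⟩ := (Submodule.mem_span_range_iff_exists_fun ℝ).1 hf
  exact ⟨c, hc.symm⟩

lemma proj_of_mem_span {e : κ → H} (he : Orthonormal ℝ e) {f : H}
    (hf : f ∈ Submodule.span ℝ (Set.range e)) : proj e f = f := by
  obtain ⟨c, rfl⟩ := exists_eq_sum_of_mem_span hf
  exact proj_sum_smul he c

lemma inner_proj_self {e : κ → H} (he : Orthonormal ℝ e) (f : H) :
    inner ℝ (proj e f) f = ‖proj e f‖ ^ 2 := by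
  rw [← real_inner_self_eq_norm_sq, inner_proj_left e f (proj e f),
    proj_of_mem_span he (proj_mem e f), real_inner_comm]

lemma norm_sq_eq_proj_add {e : κ → H} (he : Orthonormal ℝ e) (f : H) :
    ‖f‖ ^ 2 = ‖proj e f‖ ^ 2 + ‖f - proj e f‖ ^ 2 := by
  rw [norm_sub_sq_real, real_inner_comm, inner_proj_self he]
  ring

lemma norm_proj_le {e : κ → H} (he : Orthonormal ℝ e) (f : H) : ‖proj e f‖ ≤ ‖f‖ := by
  have := norm_sq_eq_proj_add he f
  exact (sq_le_sq₀ (norm_nonneg _) (norm_nonneg _)).1 (by nlinarith [sq_nonneg ‖f - proj e f‖])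

lemma norm_sub_proj_le {e : κ → H} (he : Orthonormal ℝ e) (f : H) : ‖f - proj e f‖ ≤ ‖f‖ := by
  have := norm_sq_eq_proj_add he f
  exact (sq_le_sq₀ (norm_nonneg _) (norm_nonneg _)).1 (by nlinarith [sq_nonneg ‖proj e f‖])

lemma inner_sub_proj_left (e : κ → H) (f g : H) :
    inner ℝ (f - proj e f) g = inner ℝ f (g - proj e g) := by
  rw [inner_sub_left, inner_sub_right, inner_proj_left]

/-- For two subspaces of the same finite dimension the largest principal angle does not depend
on the order of the subspaces.  If `δ < 1`, projection maps the first subspace onto the second,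
so every `y` in the second is `P' x` with `‖y‖² ≥ (1 - δ²) ‖x‖²`, and `⟨y, x⟩ = ‖y‖²`. -/
lemma norm_sub_proj_le_of_swap {e e' : κ → H} (he : Orthonormal ℝ e) (he' : Orthonormal ℝ e')
    {δ : ℝ} (hδ : 0 ≤ δ)
    (h : ∀ x ∈ Submodule.span ℝ (Set.range e), ‖x - proj e' x‖ ≤ δ * ‖x‖)
    {y : H} (hy : y ∈ Submodule.span ℝ (Set.range e')) : ‖y - proj e y‖ ≤ δ * ‖y‖ := by
  rcases le_or_gt 1 δ with h1 | h1
  · exact (norm_sub_proj_le he y).trans (le_mul_of_one_le_left (norm_nonneg _) h1)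
  let L : (κ → ℝ) →ₗ[ℝ] (κ → ℝ) :=
    { toFun := fun c ρ => inner ℝ (∑ k, c k • e k) (e' ρ)
      map_add' := fun c c' => by
        ext ρ; simp [add_smul, Finset.sum_add_distrib, inner_add_left]
      map_smul' := fun t c => by
        ext ρ; simp [mul_smul, ← Finset.smul_sum, inner_smul_left] }
  have hL : ∀ c, proj e' (∑ k, c k • e k) = ∑ ρ, L c ρ • e' ρ := fun c => rfl
  have hmem : ∀ c : κ → ℝ, ∑ k, c k • e k ∈ Submodule.span ℝ (Set.range e) := fun c =>
    Submodule.sum_mem _ fun k _ => Submodule.smul_mem _ _ (Submodule.subset_span ⟨k, rfl⟩)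
  have hinj : Function.Injective L := by
    rw [← LinearMap.ker_eq_bot, LinearMap.ker_eq_bot']
    intro c hc
    have h2 := h _ (hmem c)
    rw [hL, hc] at h2
    simp only [Pi.zero_apply, zero_smul, Finset.sum_const_zero, sub_zero] at h2
    have h3 : ‖∑ k, c k • e k‖ = 0 := by nlinarith [norm_nonneg (∑ k, c k • e k)]
    have h4 := norm_sq_sum_orthonormal he c
    rw [h3] at h4
    ext k
    have := (Finset.sum_eq_zero_iff_of_nonneg (fun k _ => sq_nonneg (c k))).1
      (by simpa using h4.symm) k (Finset.mem_univ k)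
    simpa using this
  obtain ⟨b, rfl⟩ := exists_eq_sum_of_mem_span hy
  obtain ⟨c, hc⟩ := LinearMap.injective_iff_surjective.1 hinj b
  set x := ∑ k, c k • e k with hx
  have hxy : proj e' x = ∑ k, b k • e' k := by rw [hx, hL, hc]
  rw [← hxy]
  set z := proj e' x
  have h1' : ‖x - z‖ ^ 2 ≤ (δ * ‖x‖) ^ 2 := by gcongr; exact h x (hmem c)
  have h2 : ‖x‖ ^ 2 = ‖z‖ ^ 2 + ‖x - z‖ ^ 2 := norm_sq_eq_proj_add he' x
  have h3 : inner ℝ z x = ‖z‖ ^ 2 := inner_proj_self he' x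
  have h4 : inner ℝ (proj e z) x = ‖z‖ ^ 2 := by
    rw [inner_proj_left, proj_of_mem_span he (hmem c), h3]
  have h5 : ‖z‖ ^ 2 ≤ ‖proj e z‖ * ‖x‖ := h4 ▸ real_inner_le_norm _ _
  have h6 : ‖z‖ ^ 2 = ‖proj e z‖ ^ 2 + ‖z - proj e z‖ ^ 2 := norm_sq_eq_proj_add he z
  rcases eq_or_lt_of_le (norm_nonneg x) with hx0 | hx0
  · have : x = 0 := norm_eq_zero.1 hx0.symm
    have hz : z = 0 := by
      have : ‖z‖ ^ 2 = 0 := by nlinarith [sq_nonneg ‖z‖, sq_nonneg ‖x - z‖]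
      simpa using this
    simp [hz, proj]
  refine (sq_le_sq₀ (norm_nonneg _) (by positivity)).1 ?_
  have h7 : (‖z‖ ^ 2) ^ 2 ≤ ‖proj e z‖ ^ 2 * ‖x‖ ^ 2 := by
    rw [← mul_pow]; exact pow_le_pow_left₀ (sq_nonneg _) h5 2
  have h8 : (1 - δ ^ 2) * ‖x‖ ^ 2 ≤ ‖z‖ ^ 2 := by nlinarith
  have h9 : (1 - δ ^ 2) * ‖z‖ ^ 2 * ‖x‖ ^ 2 ≤ ‖proj e z‖ ^ 2 * ‖x‖ ^ 2 := by
    nlinarith [sq_nonneg ‖z‖, mul_le_mul_of_nonneg_left h8 (sq_nonneg ‖z‖)]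
  have h10 := le_of_mul_le_mul_right h9 (by positivity)
  rw [mul_pow]
  linarith

/-- The transpose of the previous bound: `‖P' (1 - P) Y‖ ≤ δ ‖Y‖`. -/
lemma norm_proj_sub_proj_le {κ' : Type*} [Fintype κ'] {e : κ → H} {e' : κ' → H}
    (he' : Orthonormal ℝ e') {δ : ℝ} (hδ : 0 ≤ δ)
    (h : ∀ y ∈ Submodule.span ℝ (Set.range e'), ‖y - proj e y‖ ≤ δ * ‖y‖) (Y : H) :
    ‖proj e' (Y - proj e Y)‖ ≤ δ * ‖Y‖ := by
  set t := proj e' (Y - proj e Y) with ht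
  have h1 : ‖t‖ ^ 2 = inner ℝ (t - proj e t) Y := by
    rw [inner_sub_proj_left, ht, inner_proj_self he']
  have h2 : ‖t‖ ^ 2 ≤ ‖t‖ * (δ * ‖Y‖) := by
    rw [h1]
    refine (real_inner_le_norm _ _).trans ?_
    calc _ ≤ (δ * ‖t‖) * ‖Y‖ := by gcongr; exact h t (proj_mem _ _)
      _ = _ := by ring
  rcases eq_or_lt_of_le (norm_nonneg t) with h0 | h0
  · rw [← h0]; positivity
  · rw [pow_two] at h2; exact le_of_mul_le_mul_left h2 h0

end Hilbert

/-! ### Perturbation of ranges of finite-rank operators -/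

section RangeEstimation

variable {X Y : Type*} [NormedAddCommGroup X] [InnerProductSpace ℝ X]
  [NormedAddCommGroup Y] [InnerProductSpace ℝ Y]

/-- A finite-rank operator in singular value form is bounded below, on the span of its right
singular vectors, by the smallest singular value. -/
lemma norm_svd_apply_ge {κ : Type*} [Fintype κ] {Φ : κ → X} {Ψ : κ → Y} (hΦ : Orthonormal ℝ Φ)
    (hΨ : Orthonormal ℝ Ψ) {σ : κ → ℝ} {s : ℝ} (hs : 0 ≤ s) (hσ : ∀ k, s ≤ σ k) (c : κ → ℝ) :
    s * ‖∑ k, c k • Ψ k‖ ≤ ‖∑ k, (σ k * c k) • Φ k‖ := by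
  refine (sq_le_sq₀ (by positivity) (norm_nonneg _)).1 ?_
  rw [mul_pow, norm_sq_sum_orthonormal hΦ, norm_sq_sum_orthonormal hΨ, Finset.mul_sum]
  refine Finset.sum_le_sum fun k _ => ?_
  rw [mul_pow]
  have := hσ k
  gcongr

/-- Eckart--Young: if `B'` of rank at most `r` is within `ε` of an operator with singular values
`s 0 ≥ s 1 ≥ ⋯`, then `s r ≤ ε` (with `r` counted from zero). -/
lemma singularValue_le_of_rank_le {q r : ℕ} (hrq : r < q) {s : Fin q → ℝ} (hs : Antitone s)
    (hs0 : ∀ i, 0 ≤ s i) {U : Fin q → X} {V : Fin q → Y} (hU : Orthonormal ℝ U)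
    (hV : Orthonormal ℝ V) {B B' : Y → X} (hB : ∀ g, B g = ∑ i, (s i * inner ℝ g (V i)) • U i)
    (L : Y →ₗ[ℝ] (Fin r → ℝ)) (hL : ∀ g, L g = 0 → B' g = 0) {ε : ℝ}
    (hε : ∀ g, ‖B g - B' g‖ ≤ ε * ‖g‖) : s ⟨r, hrq⟩ ≤ ε := by
  let emb : Fin (r + 1) → Fin q := Fin.castLE hrq
  have hemb : Function.Injective emb := Fin.castLE_injective hrq
  let V' : Fin (r + 1) → Y := V ∘ emb
  have hV' : Orthonormal ℝ V' := hV.comp emb hemb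
  have hU' : Orthonormal ℝ (U ∘ emb) := hU.comp emb hemb
  let S : (Fin (r + 1) → ℝ) →ₗ[ℝ] (Fin r → ℝ) := L ∘ₗ Fintype.linearCombination ℝ V'
  obtain ⟨c, hc, hc0⟩ : ∃ c, S c = 0 ∧ c ≠ 0 := by
    have : S.ker ≠ ⊥ := LinearMap.ker_ne_bot_of_finrank_lt (by simp)
    obtain ⟨c, hc, hc0⟩ := Submodule.exists_mem_ne_zero_of_ne_bot this
    exact ⟨c, hc, hc0⟩
  set x := ∑ k, c k • V' k with hx
  have hLx : L x = 0 := by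
    have : Fintype.linearCombination ℝ V' c = x := by simp [Fintype.linearCombination_apply, hx]
    rw [← this]; exact hc
  have hBx : B x = ∑ k, (s (emb k) * c k) • U (emb k) := by
    rw [hB]
    have hin : ∀ i, i ∉ Set.range emb → inner ℝ x (V i) = 0 := by
      intro i hi
      rw [hx, sum_inner]
      refine Finset.sum_eq_zero fun k _ => ?_
      rw [inner_smul_left, show V' k = V (emb k) from rfl, hV.2 (fun h => hi ⟨k, h⟩), mul_zero]
    symm
    refine Finset.sum_of_injOn emb hemb.injOn (by simp) ?_ ?_
    · intro i _ hi
      rw [hin i (by simpa using hi)]; simp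
    · intro k _
      rw [show V (emb k) = V' k from rfl, hx, inner_sum_orthonormal hV']
  have h1 := norm_svd_apply_ge hU' hV' (hs0 ⟨r, hrq⟩) (σ := fun k => s (emb k)) (fun k => hs
    (Fin.le_def.2 (Nat.lt_succ_iff.1 k.2))) c
  have h2 := hε x
  rw [hL x hLx, sub_zero, hBx] at h2
  have hx0 : 0 < ‖x‖ := by
    rw [norm_pos_iff]
    intro h0
    apply hc0
    ext k
    have := inner_sum_orthonormal hV' c k
    rw [← hx, h0, inner_zero_left] at this
    simpa using this.symm
  exact le_of_mul_le_mul_right (h1.trans h2) hx0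

/-- What the leading `r` left singular vectors of `B` miss of its range. -/
lemma norm_sub_proj_leading_le {q r : ℕ} (hrq : r ≤ q) {s : Fin q → ℝ}
    {U : Fin q → X} {V : Fin q → Y} (hU : Orthonormal ℝ U)
    (hV : Orthonormal ℝ V) {B : Y → X} (hB : ∀ g, B g = ∑ i, (s i * inner ℝ g (V i)) • U i)
    (hs0 : ∀ i, 0 ≤ s i) {ε : ℝ} (hε0 : 0 ≤ ε) (hε : ∀ i : Fin q, r ≤ i → s i ≤ ε) (g : Y) :
    ‖B g - proj (fun i : Fin r => U (Fin.castLE hrq i)) (B g)‖ ≤ ε * ‖g‖ := by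
  have hBU : ∀ i, inner ℝ (B g) (U i) = s i * inner ℝ g (V i) := fun i => by
    rw [hB, inner_sum_orthonormal hU]
  have hproj : proj (fun i : Fin r => U (Fin.castLE hrq i)) (B g)
      = ∑ i : Fin q, (if (i : ℕ) < r then s i * inner ℝ g (V i) else 0) • U i := by
    unfold proj
    refine Finset.sum_of_injOn (Fin.castLE hrq) (Fin.castLE_injective hrq).injOn (by simp) ?_ ?_
    · intro i _ hi
      rw [if_neg, zero_smul]
      intro h
      exact hi ⟨⟨i, h⟩, by simp, by ext; simp⟩
    · intro i _
      simp [hBU]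
  rw [hproj, hB, ← Finset.sum_sub_distrib]
  simp_rw [← sub_smul]
  refine (sq_le_sq₀ (norm_nonneg _) (by positivity)).1 ?_
  rw [norm_sq_sum_orthonormal hU, mul_pow]
  calc _ ≤ ∑ i, ε ^ 2 * inner ℝ g (V i) ^ 2 := by
        refine Finset.sum_le_sum fun i _ => ?_
        split_ifs with h
        · rw [sub_self, zero_pow two_ne_zero]; positivity
        · rw [sub_zero, mul_pow]
          have := hε i (not_lt.1 h)
          have := hs0 i
          gcongr
    _ = ε ^ 2 * ‖proj V g‖ ^ 2 := by rw [← Finset.mul_sum, norm_sq_proj hV]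
    _ ≤ _ := by gcongr; exact norm_proj_le hV g

/-- Perturbation bound for range estimation by sketching.  Here `TA` is the target operator,
`TL` its sketch, `Q ∘ TL` the sketch projected to the estimation space and `B` the noisy version
of the latter.  The sketch only has to preserve the range of `TA`, so it may be off by a constant
fraction of the smallest singular value; every `x` in that range is `TL h` with
`‖h‖ ≤ (2 / s₀) ‖x‖`, and the two smaller errors act on `h`. -/
theorem norm_sub_proj_range_le {r q : ℕ} {Φ : Fin r → X} {Ψ : Fin r → Y}
    (hΦ : Orthonormal ℝ Φ) (hΨ : Orthonormal ℝ Ψ) {σ : Fin r → ℝ} {s₀ : ℝ} (hs₀ : 0 < s₀)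
    (hσ : ∀ k, s₀ ≤ σ k) {TA B : Y → X} {TL : Y →ₗ[ℝ] X} {Q : X →ₗ[ℝ] X}
    (hTA : ∀ g, TA g = ∑ k, (σ k * inner ℝ g (Ψ k)) • Φ k)
    (hTL : ∀ g, TL g ∈ Submodule.span ℝ (Set.range Φ))
    (hAL : ∀ g, ‖TA g - TL g‖ ≤ s₀ / 2 * ‖g‖)
    {η : ℝ} (hLB : ∀ g, ‖TL g - Q (TL g)‖ ≤ η * ‖g‖)
    (hrq : r ≤ q) {s : Fin q → ℝ} (hs : Antitone s) (hs0 : ∀ i, 0 ≤ s i)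
    {U : Fin q → X} {V : Fin q → Y} (hU : Orthonormal ℝ U) (hV : Orthonormal ℝ V)
    (hB : ∀ g, B g = ∑ i, (s i * inner ℝ g (V i)) • U i)
    {ε : ℝ} (hε0 : 0 ≤ ε) (hε : ∀ g, ‖B g - Q (TL g)‖ ≤ ε * ‖g‖) (hη0 : 0 ≤ η)
    {x : X} (hx : x ∈ Submodule.span ℝ (Set.range Φ)) :
    ‖x - proj (fun i : Fin r => U (Fin.castLE hrq i)) x‖ ≤ 2 / s₀ * (η + 2 * ε) * ‖x‖ := by
  let coord : X →ₗ[ℝ] (Fin r → ℝ) :=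
    { toFun := fun x k => inner ℝ x (Φ k)
      map_add' := fun x y => by ext k; simp [inner_add_left]
      map_smul' := fun c x => by ext k; simp [inner_smul_left] }
  have hcoord : ∀ x ∈ Submodule.span ℝ (Set.range Φ), x = ∑ k, coord x k • Φ k := fun x hx =>
    (proj_of_mem_span hΦ hx).symm
  have hlow : ∀ c : Fin r → ℝ, s₀ / 2 * ‖∑ k, c k • Ψ k‖ ≤ ‖TL (∑ k, c k • Ψ k)‖ := by
    intro c
    have h1 := norm_svd_apply_ge hΦ hΨ hs₀.le hσ c
    have h2 : TA (∑ k, c k • Ψ k) = ∑ k, (σ k * c k) • Φ k := by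
      rw [hTA]; simp_rw [inner_sum_orthonormal hΨ]
    rw [← h2] at h1
    have h3 := hAL (∑ k, c k • Ψ k)
    have h4 := norm_sub_norm_le (TA (∑ k, c k • Ψ k)) (TL (∑ k, c k • Ψ k))
    linarith
  let S : (Fin r → ℝ) →ₗ[ℝ] (Fin r → ℝ) := coord ∘ₗ TL ∘ₗ Fintype.linearCombination ℝ Ψ
  have hS : ∀ c, S c = coord (TL (∑ k, c k • Ψ k)) := fun c => by
    simp [S, Fintype.linearCombination_apply]
  have hinj : Function.Injective S := by
    rw [← LinearMap.ker_eq_bot, LinearMap.ker_eq_bot']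
    intro c hc
    rw [hS] at hc
    have h1 : TL (∑ k, c k • Ψ k) = 0 := by
      rw [hcoord _ (hTL _), hc]; simp
    have h2 := hlow c
    rw [h1, norm_zero] at h2
    have h3 : ∑ k, c k • Ψ k = 0 := by
      rw [← norm_eq_zero]
      nlinarith [norm_nonneg (∑ k, c k • Ψ k)]
    ext k
    have := inner_sum_orthonormal hΨ c k
    rw [h3, inner_zero_left] at this
    simpa using this.symm
  obtain ⟨c, hc⟩ := LinearMap.injective_iff_surjective.1 hinj (coord x)
  set h := ∑ k, c k • Ψ k with hh
  have hTh : TL h = x := by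
    rw [hcoord _ (hTL h), hh, ← hS, hc, ← hcoord _ hx]
  have hnorm : ‖h‖ ≤ 2 / s₀ * ‖x‖ := by
    have := hlow c
    rw [← hh, hTh] at this
    rw [div_mul_eq_mul_div, le_div_iff₀ hs₀]
    linarith
  have hsε : ∀ i : Fin q, r ≤ i → s i ≤ ε := by
    intro i hi
    have hlt : r < q := lt_of_le_of_lt hi i.2
    refine (hs (Fin.le_def.2 hi : (⟨r, hlt⟩ : Fin q) ≤ i)).trans ?_
    refine singularValue_le_of_rank_le hlt hs hs0 hU hV hB (coord ∘ₗ TL) (fun g hg => ?_) hε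
    have : TL g = 0 := by
      rw [hcoord _ (hTL g), show coord (TL g) = 0 from hg]; simp
    simp [this]
  set e : Fin r → X := fun i => U (Fin.castLE hrq i)
  have he : Orthonormal ℝ e := hU.comp _ (Fin.castLE_injective hrq)
  have h3 : ‖B h - proj e (B h)‖ ≤ ε * ‖h‖ :=
    norm_sub_proj_leading_le hrq hU hV hB hs0 hε0 hsε h
  have h1 : ‖(x - Q x) - proj e (x - Q x)‖ ≤ η * ‖h‖ := by
    have := hLB h
    rw [hTh] at this
    exact (norm_sub_proj_le he _).trans this
  have h2 : ‖(Q x - B h) - proj e (Q x - B h)‖ ≤ ε * ‖h‖ := by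
    have := hε h
    rw [hTh, norm_sub_rev] at this
    exact (norm_sub_proj_le he _).trans this
  have hsplit : x - proj e x = ((x - Q x) - proj e (x - Q x))
      + ((Q x - B h) - proj e (Q x - B h)) + (B h - proj e (B h)) := by
    have : proj e x = proj e (x - Q x) + proj e (Q x - B h) + proj e (B h) := by
      rw [← proj_add, ← proj_add]; congr 1; abel
    rw [this]; abel
  rw [hsplit]
  refine (norm_add₃_le).trans ?_
  calc _ ≤ (η + 2 * ε) * ‖h‖ := by linarith
    _ ≤ (η + 2 * ε) * (2 / s₀ * ‖x‖) := by gcongr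
    _ = _ := by ring

end RangeEstimation

/-! ### Kronecker products of weighted bounds -/

/-- If each matrix `C i` satisfies `‖C i x‖² ≤ c ∑ₐ w i a (x a)²`, then their Kronecker product
satisfies the analogous bound with the product weights and `c ^ n`. -/
theorem sum_sq_kronecker_le {c : ℝ} (hc : 0 ≤ c) : ∀ (n : ℕ) {R K : Fin n → Type}
    [∀ i, Fintype (R i)] [∀ i, Fintype (K i)] (C : ∀ i, R i → K i → ℝ) (w : ∀ i, K i → ℝ),
    (∀ i a, 0 ≤ w i a) →
    (∀ i (x : K i → ℝ), ∑ ρ, (∑ a, C i ρ a * x a) ^ 2 ≤ c * ∑ a, w i a * x a ^ 2) →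
    ∀ z : (∀ i, K i) → ℝ, ∑ ρ : (∀ i, R i), (∑ a : (∀ i, K i), (∏ i, C i (ρ i) (a i)) * z a) ^ 2
      ≤ c ^ n * ∑ a : (∀ i, K i), (∏ i, w i (a i)) * z a ^ 2
  | 0, R, K, _, _, C, w, _, _, z => by simp
  | n + 1, R, K, _, _, C, w, hw, h, z => by
    have ih := sum_sq_kronecker_le hc n (fun i : Fin n => C i.succ) (fun i => w i.succ)
      (fun i => hw i.succ) (fun i => h i.succ)
    have e1 : ∀ f : (∀ i, R i) → ℝ, ∑ ρ, f ρ = ∑ ρ₀ : R 0, ∑ ρ' : (∀ i : Fin n, R i.succ),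
        f (Fin.cons ρ₀ ρ') := fun f => by
      rw [← (Fin.consEquiv R).sum_comp, Fintype.sum_prod_type]; rfl
    have e2 : ∀ f : (∀ i, K i) → ℝ, ∑ a, f a = ∑ a' : (∀ i : Fin n, K i.succ), ∑ a₀ : K 0,
        f (Fin.cons a₀ a') := fun f => by
      rw [← (Fin.consEquiv K).sum_comp, Fintype.sum_prod_type_right]; rfl
    simp only [e1, e2, Fin.prod_univ_succ, Fin.cons_zero, Fin.cons_succ]
    calc _ = ∑ ρ₀, ∑ ρ' : (∀ i : Fin n, R i.succ), (∑ a' : (∀ i : Fin n, K i.succ),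
          (∏ i, C i.succ (ρ' i) (a' i)) * ∑ a₀, C 0 ρ₀ a₀ * z (Fin.cons a₀ a')) ^ 2 := by
            refine Finset.sum_congr rfl fun ρ₀ _ => Finset.sum_congr rfl fun ρ' _ => ?_
            congr 1
            refine Finset.sum_congr rfl fun a' _ => ?_
            rw [Finset.mul_sum]
            exact Finset.sum_congr rfl fun a₀ _ => by ring
      _ ≤ ∑ ρ₀, c ^ n * ∑ a' : (∀ i : Fin n, K i.succ), (∏ i, w i.succ (a' i))
            * (∑ a₀, C 0 ρ₀ a₀ * z (Fin.cons a₀ a')) ^ 2 :=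
          Finset.sum_le_sum fun ρ₀ _ => ih _
      _ = c ^ n * ∑ a' : (∀ i : Fin n, K i.succ), (∏ i, w i.succ (a' i))
            * ∑ ρ₀, (∑ a₀, C 0 ρ₀ a₀ * z (Fin.cons a₀ a')) ^ 2 := by
          rw [← Finset.mul_sum, Finset.sum_comm]
          simp_rw [Finset.mul_sum]
      _ ≤ c ^ n * ∑ a' : (∀ i : Fin n, K i.succ), (∏ i, w i.succ (a' i))
            * (c * ∑ a₀, w 0 a₀ * z (Fin.cons a₀ a') ^ 2) := by
          gcongr with a' _
          · exact Finset.prod_nonneg fun i _ => hw _ _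
          · exact h 0 _
      _ = _ := by
          simp_rw [Finset.mul_sum]
          refine Finset.sum_congr rfl fun a' _ => Finset.sum_congr rfl fun a₀ _ => ?_
          ring

/-! ### Products of functions -/

section Tensors

variable {O : Set ℝ} {ι : Type} [Fintype ι]

lemma coeFn_pureTensor (f : ι → L2one O) :
    pureTensor f =ᵐ[Measure.pi fun _ : ι => (volume : Measure ℝ).restrict O]
      fun z => ∏ i, f i (z i) :=
  MemLp.coeFn_toLp _

lemma inner_pureTensor (f g : ι → L2one O) :
    inner ℝ (pureTensor f) (pureTensor g) = ∏ i, inner ℝ (f i) (g i) := by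
  simp_rw [L2.inner_def]
  rw [← integral_fintype_prod_eq_prod (𝕜 := ℝ) (f := fun i x => inner ℝ (f i x) (g i x))]
  refine integral_congr_ae ?_
  filter_upwards [coeFn_pureTensor f, coeFn_pureTensor g] with z h1 h2
  simp only [h1, h2]
  simp [Finset.prod_mul_distrib]

lemma norm_pureTensor (f : ι → L2one O) : ‖pureTensor f‖ = ∏ i, ‖f i‖ := by
  have h : ‖pureTensor f‖ ^ 2 = (∏ i, ‖f i‖) ^ 2 := by
    rw [← real_inner_self_eq_norm_sq, inner_pureTensor, ← Finset.prod_pow]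
    simp
  exact (sq_eq_sq₀ (norm_nonneg _) (Finset.prod_nonneg fun _ _ => norm_nonneg _)).1 h

lemma orthonormal_pureTensor {κ : ι → Type*} {e : ∀ i, κ i → L2one O}
    (he : ∀ i, Orthonormal ℝ (e i)) :
    Orthonormal ℝ (fun ρ : (∀ i, κ i) => pureTensor fun i => e i (ρ i)) := by
  constructor
  · intro ρ
    rw [norm_pureTensor]
    exact Finset.prod_eq_one fun i _ => (he i).1 _
  · intro ρ ρ' hne
    obtain ⟨i, hi⟩ := Function.ne_iff.1 hne
    rw [inner_pureTensor]
    exact Finset.prod_eq_zero (Finset.mem_univ i) ((he i).2 hi)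

/-- A square-integrable function orthogonal to all products of functions of one variable vanishes:
its integrals over bounded boxes, hence over all bounded measurable sets, are zero. -/
lemma eq_zero_of_inner_pureTensor (A : L2 O ι) (h : ∀ f, inner ℝ A (pureTensor f) = 0) :
    A = 0 := by
  set μ := Measure.pi fun _ : ι => (volume : Measure ℝ).restrict O with hμ
  let cube : ℕ → Set (ι → ℝ) := fun n => Set.univ.pi fun _ => Set.Icc (-(n : ℝ)) n
  have hcube : ∀ n, MeasurableSet (cube n) := fun n =>
    MeasurableSet.univ_pi fun _ => measurableSet_Icc
  have hbox : ∀ t : ι → Set ℝ, (∀ i, MeasurableSet (t i)) → ∀ n : ℕ,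
      ∫ z in Set.univ.pi t, A z ∂(μ.restrict (cube n)) = 0 := by
    intro t ht n
    have hm : ∀ i, MeasurableSet (t i ∩ Set.Icc (-(n : ℝ)) n) := fun i =>
      (ht i).inter measurableSet_Icc
    have hfin : ∀ i, ((volume : Measure ℝ).restrict O) (t i ∩ Set.Icc (-(n : ℝ)) n) ≠ ⊤ := by
      intro i
      refine ne_top_of_le_ne_top ?_ ((measure_mono Set.inter_subset_right).trans
        (Measure.restrict_apply_le _ _))
      simp
    have h0 := h fun i => indicatorConstLp 2 (hm i) (hfin i) (1 : ℝ)
    rw [Measure.restrict_restrict (MeasurableSet.univ_pi ht), ← Set.pi_inter_distrib,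
      ← integral_indicator (MeasurableSet.univ_pi hm), ← h0, L2.inner_def]
    refine integral_congr_ae ?_
    have hae : ∀ᵐ z ∂μ, ∀ i, (indicatorConstLp 2 (hm i) (hfin i) (1 : ℝ) : L2one O) (z i)
        = (t i ∩ Set.Icc (-(n : ℝ)) n).indicator (fun _ => (1 : ℝ)) (z i) :=
      ae_all_iff.2 fun i => (Measure.quasiMeasurePreserving_eval _ i).ae indicatorConstLp_coeFn
    filter_upwards [hae, coeFn_pureTensor fun i =>
      (indicatorConstLp 2 (hm i) (hfin i) (1 : ℝ) : L2one O)] with z h1 h2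
    rw [h2]
    simp only [h1]
    by_cases hz : z ∈ Set.univ.pi fun i => t i ∩ Set.Icc (-(n : ℝ)) n
    · rw [Set.indicator_of_mem hz, Finset.prod_eq_one]
      · simp
      · intro i _
        rw [Set.indicator_of_mem (hz i (Set.mem_univ i))]
    · rw [Set.indicator_of_notMem hz]
      obtain ⟨i, hi⟩ : ∃ i, z i ∉ t i ∩ Set.Icc (-(n : ℝ)) n := by
        by_contra! hc
        exact hz fun i _ => hc i
      rw [Finset.prod_eq_zero (Finset.mem_univ i) (Set.indicator_of_notMem hi _)]
      simp
  have hzero : ∀ n, ∀ᵐ z ∂(μ.restrict (cube n)), A z = 0 := by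
    intro n
    have : IsFiniteMeasure (μ.restrict (cube n)) := by
      refine ⟨?_⟩
      rw [Measure.restrict_apply_univ, hμ, Measure.pi_pi]
      refine ENNReal.prod_lt_top fun i _ => lt_of_le_of_lt (Measure.restrict_apply_le _ _) ?_
      simp
    have hint : Integrable A (μ.restrict (cube n)) :=
      ((Lp.memLp A).restrict (cube n)).integrable (by norm_num)
    refine hint.ae_eq_zero_of_forall_setIntegral_eq_zero fun s hs _ => ?_
    have hgen : (MeasurableSpace.pi : MeasurableSpace (ι → ℝ)) = MeasurableSpace.generateFrom
        (Set.univ.pi '' Set.univ.pi fun _ => {s : Set ℝ | MeasurableSet s}) := generateFrom_pi.symm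
    have hpi : IsPiSystem
        (Set.univ.pi '' Set.univ.pi fun _ : ι => {s : Set ℝ | MeasurableSet s}) := isPiSystem_pi
    induction s, hs using MeasurableSpace.induction_on_inter hgen hpi with
    | empty => simp
    | basic s hs =>
      obtain ⟨t, ht, rfl⟩ := hs
      exact hbox t (fun i => ht i (Set.mem_univ i)) n
    | compl s hs ih =>
      have h1 := integral_add_compl hs hint
      have h2 := hbox (fun _ => Set.univ) (fun _ => MeasurableSet.univ) n
      rw [Set.pi_univ, Measure.restrict_univ] at h2
      rw [ih (measure_lt_top _ _), h2, zero_add] at h1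
      exact h1
    | iUnion s hd hs ih =>
      rw [integral_iUnion hs hd hint.integrableOn]
      simp [fun i => ih i (measure_lt_top _ _)]
  have hU : ⋃ n, cube n = Set.univ := by
    refine Set.eq_univ_of_forall fun z => Set.mem_iUnion.2 ?_
    obtain ⟨n, hn⟩ := exists_nat_ge (∑ i, |z i|)
    refine ⟨n, fun i _ => ?_⟩
    exact abs_le.1 ((Finset.single_le_sum (fun i _ => abs_nonneg (z i))
      (Finset.mem_univ i)).trans hn)
  refine Lp.ext ?_
  have hall := (ae_restrict_iUnion_iff cube fun z => A z = 0).2 hzero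
  rw [hU, Measure.restrict_univ] at hall
  filter_upwards [hall, Lp.coeFn_zero ℝ 2 μ] with z h1 h2
  rw [h1, h2]; rfl

lemma dense_span_pureTensor :
    Dense (Submodule.span ℝ (Set.range (pureTensor (O := O) (ι := ι))) : Set (L2 O ι)) := by
  rw [Submodule.dense_iff_topologicalClosure_eq_top, Submodule.topologicalClosure_eq_top_iff,
    Submodule.eq_bot_iff]
  intro A hA
  refine eq_zero_of_inner_pureTensor A fun f => ?_
  rw [real_inner_comm]
  exact (Submodule.mem_orthogonal _ _).1 hA _ (Submodule.subset_span ⟨f, rfl⟩)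

variable [DecidableEq ι]

lemma tensorAt_apply (j : ι) (f : L2one O) (g : L2 O (Others j)) :
    tensorAt j f g = tensorFun j f g := rfl

lemma inner_tensorAt (j : ι) (f f' : L2one O) (g g' : L2 O (Others j)) :
    inner ℝ (tensorAt j f g) (tensorAt j f' g') = inner ℝ f f' * inner ℝ g g' := by
  have hn : ∀ (f : L2one O) (g : L2 O (Others j)), ‖tensorAt j f g‖ ^ 2 = ‖f‖ ^ 2 * ‖g‖ ^ 2 :=
    fun f g => by rw [tensorAt_apply, norm_tensorFun, mul_pow]
  simp_rw [L2.inner_def]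
  rw [← integral_prod_mul, ← (measurePreserving_split O j).map_eq,
    integral_map (measurePreserving_split O j).measurable.aemeasurable]
  · refine integral_congr_ae ?_
    filter_upwards [coeFn_tensorFun j f g, coeFn_tensorFun j f' g'] with z h1 h2
    simp only [tensorAt_apply, h1, h2]
    simp
    ring
  · rw [(measurePreserving_split O j).map_eq]
    exact ((Lp.aestronglyMeasurable f).inner (Lp.aestronglyMeasurable f')).comp_fst.mul
      ((Lp.aestronglyMeasurable g).inner (Lp.aestronglyMeasurable g')).comp_snd

/-- A product of functions with the `j`-th factor split off. -/
lemma pureTensor_eq_tensorAt (j : ι) (f : ι → L2one O) :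
    pureTensor f = tensorAt j (f j) (pureTensor fun i : Others j => f i) := by
  rw [tensorAt_apply]
  refine Lp.ext ?_
  have q := (Measure.quasiMeasurePreserving_snd.comp
    (measurePreserving_split O j).quasiMeasurePreserving)
  filter_upwards [coeFn_pureTensor f, coeFn_tensorFun j (f j) (pureTensor fun i : Others j => f i),
    q.ae (coeFn_pureTensor fun i : Others j => f i)] with z h1 h2 h3
  simp only [Function.comp_apply] at h3
  rw [h1, h2, h3]
  simp only [split]
  rw [← Fintype.prod_subtype_mul_prod_subtype (fun i => i = j)]
  congr 1
  simp only [Finset.univ_unique, Finset.prod_singleton]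
  rfl

lemma pureTensor_update (j : ι) (f : ι → L2one O) (u : L2one O) :
    pureTensor (Function.update f j u)
      = tensorAt j u (pureTensor fun i : Others j => f i) := by
  rw [pureTensor_eq_tensorAt j]
  congr 2
  · simp
  · ext1 i
    rw [Function.update_of_ne i.2]

variable (O ι) in
/-- The product of functions of one variable, as a multilinear map. -/
noncomputable def pureTensorMulti : MultilinearMap ℝ (fun _ : ι => L2one O) (L2 O ι) where
  toFun := pureTensor
  map_update_add' f j u v := by
    classical
    convert (show pureTensor (Function.update f j (u + v))
        = pureTensor (Function.update f j u) + pureTensor (Function.update f j v) by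
      simp only [pureTensor_update, map_add, add_apply])
  map_update_smul' f j c u := by
    classical
    convert (show pureTensor (Function.update f j (c • u))
        = c • pureTensor (Function.update f j u) by
      simp only [pureTensor_update, map_smul, smul_apply])

lemma pureTensor_sum {κ : ι → Type*} [∀ i, Fintype (κ i)] (c : ∀ i, κ i → ℝ)
    (e : ∀ i, κ i → L2one O) :
    pureTensor (fun i => ∑ a, c i a • e i a)
      = ∑ a : (∀ i, κ i), (∏ i, c i (a i)) • pureTensor fun i => e i (a i) := by
  have h := (pureTensorMulti O ι).map_sum (fun i a => c i a • e i a)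
  simp_rw [MultilinearMap.map_smul_univ] at h
  exact h

end Tensors

/-! ### Partial integrals and projected functionals -/

section Contraction

variable {O : Set ℝ} {ι : Type} [Fintype ι] [DecidableEq ι]

lemma inner_contract (j : ι) (w : L2 O (Others j)) (A : L2 O ι) (u : L2one O) :
    inner ℝ (contract j w A) u = inner ℝ A (tensorAt j u w) := by
  rw [contract, ContinuousLinearMap.adjoint_inner_left]; rfl

lemma contract_add_left (j : ι) (w w' : L2 O (Others j)) (A : L2 O ι) :
    contract j (w + w') A = contract j w A + contract j w' A :=
  ext_inner_right ℝ fun u => by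
    simp only [inner_contract, inner_add_left, map_add, inner_add_right]

lemma contract_smul_left (j : ι) (c : ℝ) (w : L2 O (Others j)) (A : L2 O ι) :
    contract j (c • w) A = c • contract j w A :=
  ext_inner_right ℝ fun u => by
    simp only [inner_contract, inner_smul_left, map_smul, inner_smul_right]; simp

lemma contract_sub (j : ι) (w : L2 O (Others j)) (A B : L2 O ι) :
    contract j w (A - B) = contract j w A - contract j w B := map_sub _ _ _

lemma contract_sum {κ : Type*} (s : Finset κ) (j : ι) (w : L2 O (Others j)) (A : κ → L2 O ι) :
    contract j w (∑ k ∈ s, A k) = ∑ k ∈ s, contract j w (A k) := map_sum _ _ _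

lemma contract_smul (j : ι) (c : ℝ) (w : L2 O (Others j)) (A : L2 O ι) :
    contract j w (c • A) = c • contract j w A := map_smul _ _ _

lemma contract_tensorAt (j : ι) (g w : L2 O (Others j)) (f : L2one O) :
    contract j g (tensorAt j f w) = (inner ℝ g w : ℝ) • f :=
  ext_inner_right ℝ fun u => by
    rw [inner_contract, inner_tensorAt, inner_smul_left, real_inner_comm g w]; simp [mul_comm]

lemma norm_contract_le (j : ι) (w : L2 O (Others j)) (A : L2 O ι) :
    ‖contract j w A‖ ≤ ‖A‖ * ‖w‖ := by
  rcases eq_or_lt_of_le (norm_nonneg (contract j w A)) with h0 | h0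
  · rw [← h0]; positivity
  refine le_of_mul_le_mul_right ?_ h0
  rw [← pow_two, ← real_inner_self_eq_norm_sq, inner_contract]
  refine (real_inner_le_norm _ _).trans (le_of_eq ?_)
  rw [tensorAt_apply, norm_tensorFun]; ring

/-- The integral operator with kernel `A`, from functions of the other variables to functions of
the `j`-th one. -/
noncomputable def contractLin (j : ι) (A : L2 O ι) : L2 O (Others j) →ₗ[ℝ] L2one O where
  toFun w := contract j w A
  map_add' w w' := contract_add_left j w w' A
  map_smul' c w := contract_smul_left j c w A

lemma contractLin_apply (j : ι) (A : L2 O ι) (w : L2 O (Others j)) :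
    contractLin j A w = contract j w A := rfl

lemma contract_sum_tensorAt {κ : Type*} [Fintype κ] (j : ι) (g : L2 O (Others j)) (s : κ → ℝ)
    (U : κ → L2one O) (V : κ → L2 O (Others j)) :
    contract j g (∑ k, s k • tensorAt j (U k) (V k)) = ∑ k, (s k * inner ℝ g (V k)) • U k := by
  simp_rw [contract_sum, contract_smul, contract_tensorAt, mul_smul]

variable {κ κ' : Type*} [Fintype κ] [Fintype κ']

lemma contract_projOthers (j : ι) (g : L2 O (Others j)) (w : κ → L2 O (Others j)) (A : L2 O ι) :
    contract j g (projOthers j w A) = ∑ η, (inner ℝ g (w η) : ℝ) • contract j (w η) A := by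
  simp_rw [projOthers, contract_sum, contract_tensorAt]

lemma inner_contract_projBoth (j : ι) (v : κ → L2one O) (w : κ' → L2 O (Others j))
    (T : L2 O ι →ₗ[ℝ] ℝ) (g : L2 O (Others j)) (f : L2one O) :
    inner ℝ (contract j g (projBoth j v w T)) f = T (tensorAt j (proj v f) (proj w g)) := by
  simp only [projBoth, proj, map_sum, contract_sum, contract_smul, contract_tensorAt, sum_inner,
    inner_smul_left, map_smul, sum_apply, smul_apply,
    Finset.smul_sum, smul_eq_mul]
  rw [Finset.sum_comm]
  refine Finset.sum_congr rfl fun η _ => Finset.sum_congr rfl fun μ _ => ?_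
  rw [real_inner_comm (v μ) f]
  simp only [conj_trivial]
  ring

lemma contract_projBoth_functional (j : ι) (v : κ → L2one O) (w : κ' → L2 O (Others j))
    (A : L2 O ι) (g : L2 O (Others j)) :
    contract j g (projBoth j v w (functional A)) = proj v (contract j g (projOthers j w A)) := by
  refine ext_inner_right ℝ fun f => ?_
  rw [inner_contract_projBoth, inner_proj_left, contract_projOthers, sum_inner]
  simp only [functional, proj, map_sum, map_smul, ContinuousLinearMap.coe_coe, innerSL_apply_apply,
    inner_smul_left, inner_contract]
  simp [inner_sum, inner_smul_right]

lemma projBoth_sub (j : ι) (v : κ → L2one O) (w : κ' → L2 O (Others j)) (T T' : L2 O ι →ₗ[ℝ] ℝ) :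
    projBoth j v w (T - T') = projBoth j v w T - projBoth j v w T' := by
  simp [projBoth, sub_smul, Finset.sum_sub_distrib]

/-- The supremum defining `opNormProj` is a genuine one, for every linear functional `T`, continuous
or not: only the values of `T` on a finite-dimensional space enter. -/
lemma bddAbove_opNormProj (j : ι) (v : κ → L2one O) (w : κ' → L2 O (Others j))
    (T : L2 O ι →ₗ[ℝ] ℝ) :
    BddAbove {t : ℝ | ∃ (f : L2one O) (g : L2 O (Others j)), ‖f‖ ≤ 1 ∧ ‖g‖ ≤ 1 ∧
      t = T (tensorAt j (proj v f) (proj w g))} := by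
  refine ⟨‖projBoth j v w T‖, ?_⟩
  rintro t ⟨f, g, hf, hg, rfl⟩
  rw [← inner_contract_projBoth]
  refine (real_inner_le_norm _ _).trans ?_
  calc _ ≤ ‖projBoth j v w T‖ * 1 * 1 := by
        gcongr
        exact (norm_contract_le j g _).trans (by gcongr)
    _ = _ := by ring

/-- `opNormProj` bounds the integral operator of the projected functional. -/
lemma norm_contract_projBoth_le (j : ι) (v : κ → L2one O) (w : κ' → L2 O (Others j))
    (T : L2 O ι →ₗ[ℝ] ℝ) (g : L2 O (Others j)) :
    ‖contract j g (projBoth j v w T)‖ ≤ opNormProj j v w T * ‖g‖ := by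
  set c := contract j g (projBoth j v w T) with hc
  rcases eq_or_ne g 0 with rfl | hg
  · have := norm_contract_le j 0 (projBoth j v w T)
    simpa using this
  rcases eq_or_ne c 0 with h0 | h0
  · rw [h0, norm_zero]
    refine mul_nonneg (le_csSup (bddAbove_opNormProj j v w T) ?_) (norm_nonneg _)
    exact ⟨0, 0, by simp, by simp, by simp [proj]⟩
  have hg' : 0 < ‖g‖ := norm_pos_iff.2 hg
  have hc' : 0 < ‖c‖ := norm_pos_iff.2 h0
  have h1 : T (tensorAt j (proj v (‖c‖⁻¹ • c)) (proj w (‖g‖⁻¹ • g))) ≤ opNormProj j v w T := by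
    refine le_csSup (bddAbove_opNormProj j v w T) ⟨_, _, ?_, ?_, rfl⟩
    · rw [norm_smul, norm_inv, norm_norm, inv_mul_cancel₀ hc'.ne']
    · rw [norm_smul, norm_inv, norm_norm, inv_mul_cancel₀ hg'.ne']
  rw [← inner_contract_projBoth, contract_smul_left, ← hc, inner_smul_left, inner_smul_right,
    real_inner_self_eq_norm_sq] at h1
  simp only [map_inv₀, conj_trivial] at h1
  have h2 : ‖g‖⁻¹ * (‖c‖⁻¹ * ‖c‖ ^ 2) = ‖c‖ / ‖g‖ := by field_simp
  rw [h2, div_le_iff₀ hg'] at h1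
  exact h1

lemma opNormProj_nonneg (j : ι) (v : κ → L2one O) (w : κ' → L2 O (Others j))
    (T : L2 O ι →ₗ[ℝ] ℝ) : 0 ≤ opNormProj j v w T :=
  le_csSup (bddAbove_opNormProj j v w T) ⟨0, 0, by simp, by simp, by simp [proj]⟩

end Contraction

/-! ### Mode projections and the approximation error -/

section ModeProjections

variable {O : Set ℝ} {ι : Type} [Fintype ι] [DecidableEq ι] {κ : Type*} [Fintype κ]

lemma adjoint_tensorAt_tensorAt (j : ι) (u f : L2one O) (g : L2 O (Others j)) :
    ContinuousLinearMap.adjoint (tensorAt j u) (tensorAt j f g) = (inner ℝ f u : ℝ) • g :=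
  ext_inner_right ℝ fun h => by
    rw [ContinuousLinearMap.adjoint_inner_left, inner_tensorAt, inner_smul_left]; simp

/-- The mode product `A ↦ A ×_j P`, where `P` is the projection onto the span of `e`. -/
noncomputable def modeProj (j : ι) (e : κ → L2one O) : L2 O ι →L[ℝ] L2 O ι :=
  ∑ ρ, (tensorAt j (e ρ)) ∘L ContinuousLinearMap.adjoint (tensorAt j (e ρ))

lemma modeProj_apply (j : ι) (e : κ → L2one O) (A : L2 O ι) :
    modeProj j e A
      = ∑ ρ, tensorAt j (e ρ) (ContinuousLinearMap.adjoint (tensorAt j (e ρ)) A) := by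
  simp [modeProj, sum_apply]

lemma modeProj_tensorAt (j : ι) (e : κ → L2one O) (f : L2one O) (g : L2 O (Others j)) :
    modeProj j e (tensorAt j f g) = tensorAt j (proj e f) g := by
  simp only [modeProj_apply, adjoint_tensorAt_tensorAt, proj, map_sum, map_smul, sum_apply,
    smul_apply]

lemma norm_modeProj_le (j : ι) {e : κ → L2one O} (he : Orthonormal ℝ e) (A : L2 O ι) :
    ‖modeProj j e A‖ ≤ ‖A‖ := by
  classical
  set X := fun ρ => ContinuousLinearMap.adjoint (tensorAt j (e ρ)) A with hX
  have hA : modeProj j e A = ∑ ρ, tensorAt j (e ρ) (X ρ) := modeProj_apply j e A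
  have h1 : inner ℝ (modeProj j e A) (modeProj j e A) = ∑ ρ, ‖X ρ‖ ^ 2 := by
    rw [hA]
    simp_rw [sum_inner, inner_sum, inner_tensorAt, orthonormal_iff_ite.1 he]
    simp
  have h2 : inner ℝ (modeProj j e A) A = ∑ ρ, ‖X ρ‖ ^ 2 := by
    rw [hA, sum_inner]
    refine Finset.sum_congr rfl fun ρ _ => ?_
    rw [← ContinuousLinearMap.adjoint_inner_right, real_inner_self_eq_norm_sq]
  have h3 : ‖modeProj j e A‖ ^ 2 ≤ ‖modeProj j e A‖ * ‖A‖ := by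
    rw [← real_inner_self_eq_norm_sq, h1, ← h2]
    exact real_inner_le_norm _ _
  rcases eq_or_lt_of_le (norm_nonneg (modeProj j e A)) with h0 | h0
  · rw [← h0]; positivity
  · rw [pow_two] at h3; exact le_of_mul_le_mul_left h3 h0

lemma norm_sq_sum_tensorAt (j : ι) (s : κ → ℝ) (x : κ → L2one O) {Ψ : κ → L2 O (Others j)}
    (hΨ : Orthonormal ℝ Ψ) :
    ‖∑ k, s k • tensorAt j (x k) (Ψ k)‖ ^ 2 = ∑ k, s k ^ 2 * ‖x k‖ ^ 2 := by
  classical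
  rw [← real_inner_self_eq_norm_sq]
  simp_rw [sum_inner, inner_sum, inner_smul_left, inner_smul_right, inner_tensorAt,
    orthonormal_iff_ite.1 hΨ]
  simp
  exact Finset.sum_congr rfl fun k _ => by ring

lemma norm_sub_modeProj_le (j : ι) {κ' : Type*} [Fintype κ'] {σ : κ → ℝ} {Φ : κ → L2one O}
    {Ψ : κ → L2 O (Others j)} (hΦ : Orthonormal ℝ Φ) (hΨ : Orthonormal ℝ Ψ) {A : L2 O ι}
    (hA : A = ∑ k, σ k • tensorAt j (Φ k) (Ψ k)) (e : κ' → L2one O) {δ : ℝ} (hδ : 0 ≤ δ)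
    (h : ∀ k, ‖Φ k - proj e (Φ k)‖ ≤ δ) : ‖A - modeProj j e A‖ ≤ δ * ‖A‖ := by
  have h1 : A - modeProj j e A = ∑ k, σ k • tensorAt j (Φ k - proj e (Φ k)) (Ψ k) := by
    rw [hA, map_sum, ← Finset.sum_sub_distrib]
    refine Finset.sum_congr rfl fun k _ => ?_
    rw [map_smul, modeProj_tensorAt, ← smul_sub, map_sub, sub_apply]
  refine (sq_le_sq₀ (norm_nonneg _) (by positivity)).1 ?_
  rw [h1, mul_pow, norm_sq_sum_tensorAt j _ _ hΨ, hA, norm_sq_sum_tensorAt j _ _ hΨ,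
    Finset.mul_sum]
  refine Finset.sum_le_sum fun k _ => ?_
  rw [hΦ.1 k, one_pow, mul_one, mul_comm]
  have := h k
  gcongr

lemma norm_sub_list_prod_modeProj_le {r : ι → Type*} [∀ i, Fintype (r i)]
    {e : ∀ i, r i → L2one O} (he : ∀ i, Orthonormal ℝ (e i)) (A : L2 O ι) (js : List ι) :
    ‖A - (js.map fun j => modeProj j (e j)).prod A‖
      ≤ (js.map fun j => ‖A - modeProj j (e j) A‖).sum := by
  induction js with
  | nil => simp
  | cons j js ih =>
    simp only [List.map_cons, List.prod_cons, List.sum_cons, mul_apply_eq_comp]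
    have h : A - modeProj j (e j) ((js.map fun j => modeProj j (e j)).prod A)
        = (A - modeProj j (e j) A)
          + modeProj j (e j) (A - (js.map fun j => modeProj j (e j)).prod A) := by
      rw [map_sub]; abel
    rw [h]
    refine (norm_add_le _ _).trans ?_
    gcongr
    exact (norm_modeProj_le j (he j) _).trans ih

lemma list_prod_modeProj_pureTensor {r : ι → Type*} [∀ i, Fintype (r i)]
    (e : ∀ i, r i → L2one O) (f : ι → L2one O) (js : List ι) :
    ∃ g : ι → L2one O, (js.map fun j => modeProj j (e j)).prod (pureTensor f) = pureTensor g ∧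
      ∀ j ∈ js, g j ∈ Submodule.span ℝ (Set.range (e j)) := by
  induction js with
  | nil => exact ⟨f, by simp, by simp⟩
  | cons j js ih =>
    obtain ⟨g, hg, hmem⟩ := ih
    refine ⟨Function.update g j (proj (e j) (g j)), ?_, ?_⟩
    · rw [List.map_cons, List.prod_cons, mul_apply_eq_comp, hg,
        pureTensor_eq_tensorAt j, modeProj_tensorAt, pureTensor_update]
    · intro i hi
      by_cases hij : i = j
      · subst hij
        rw [Function.update_self]
        exact proj_mem _ _
      · rw [Function.update_of_ne hij]
        exact hmem i (by simpa [hij] using hi)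

lemma pureTensor_mem_span {r : ι → Type*} [∀ i, Fintype (r i)] {e : ∀ i, r i → L2one O}
    {g : ι → L2one O} (hg : ∀ j, g j ∈ Submodule.span ℝ (Set.range (e j))) :
    pureTensor g ∈ Submodule.span ℝ
      (Set.range fun ρ : (∀ i, r i) => pureTensor fun i => e i (ρ i)) := by
  choose c hc using fun j => exists_eq_sum_of_mem_span (hg j)
  rw [show g = fun i => ∑ a, c i a • e i a from funext hc, pureTensor_sum]
  exact Submodule.sum_mem _ fun a _ => Submodule.smul_mem _ _ (Submodule.subset_span ⟨a, rfl⟩)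

/-- Applying all mode projections, in any order, lands in the span of the products of the basis
functions.  By density of products of functions and closedness of finite-dimensional subspaces it
is enough to see this for products. -/
lemma list_prod_modeProj_mem_span {r : ι → Type*} [∀ i, Fintype (r i)]
    (e : ∀ i, r i → L2one O) (A : L2 O ι) (js : List ι) (hjs : ∀ j, j ∈ js) :
    (js.map fun j => modeProj j (e j)).prod A ∈ Submodule.span ℝ
      (Set.range fun ρ : (∀ i, r i) => pureTensor fun i => e i (ρ i)) := by
  set S := Submodule.span ℝ (Set.range fun ρ : (∀ i, r i) => pureTensor fun i => e i (ρ i))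
  set F := (js.map fun j => modeProj j (e j)).prod
  have hfin : FiniteDimensional ℝ S := FiniteDimensional.span_of_finite ℝ (Set.finite_range _)
  have hclosed : IsClosed (F ⁻¹' (S : Set (L2 O ι))) := S.closed_of_finiteDimensional.preimage F.cont
  have hsub : (Submodule.span ℝ (Set.range (pureTensor (O := O) (ι := ι))) : Set (L2 O ι))
      ⊆ F ⁻¹' (S : Set (L2 O ι)) := by
    have : Submodule.span ℝ (Set.range (pureTensor (O := O) (ι := ι)))
        ≤ S.comap F.toLinearMap := by
      rw [Submodule.span_le]
      rintro _ ⟨f, rfl⟩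
      obtain ⟨g, hg, hmem⟩ := list_prod_modeProj_pureTensor e f js
      change F (pureTensor f) ∈ S
      rw [hg]
      exact pureTensor_mem_span fun j => hmem j (hjs j)
    exact this
  exact (hclosed.closure_subset_iff.2 hsub) (dense_span_pureTensor A)

/-- The approximation error of the target by the estimated ranges is at most the sum of the
errors of the modes. -/
theorem norm_sub_finalEstimate_functional_le {r : ι → ℕ} {Φ : ∀ i, Fin (r i) → L2one O}
    (hΦ : ∀ i, Orthonormal ℝ (Φ i)) (A : L2 O ι) :
    ‖A - finalEstimate (functional A) Φ‖ ≤ ∑ j, ‖A - modeProj j (Φ j) A‖ := by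
  set E := fun ρ : (∀ i, Fin (r i)) => pureTensor fun i => Φ i (ρ i) with hE
  have hEo : Orthonormal ℝ E := orthonormal_pureTensor hΦ
  have h1 : finalEstimate (functional A) Φ = proj E A := rfl
  set js := (Finset.univ : Finset ι).toList
  set X := (js.map fun j => modeProj j (Φ j)).prod A with hX
  have hXm : X ∈ Submodule.span ℝ (Set.range E) :=
    list_prod_modeProj_mem_span Φ A js fun j => Finset.mem_toList.2 (Finset.mem_univ j)
  have h2 : A - proj E A = (A - X) - proj E (A - X) := by
    have : proj E A = proj E (A - X) + X := by
      conv_rhs => rw [← proj_of_mem_span hEo hXm, ← proj_add, proj_of_mem_span hEo hXm]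
      rw [sub_add_cancel]
    rw [this]; abel
  rw [h1, h2]
  refine (norm_sub_proj_le hEo _).trans ((norm_sub_list_prod_modeProj_le hΦ A js).trans ?_)
  rw [Finset.sum_map_toList]

end ModeProjections

/-! ### Accuracy of range estimation -/

section RangeEstimate

variable {O : Set ℝ} {ι : Type} [Fintype ι] [DecidableEq ι]

lemma IsLeadingSingularFunctions.orthonormal {j : ι} {M : Submodule ℝ (L2one O)} {A : L2 O ι}
    {r : ℕ} {Φ : Fin r → L2one O} (h : IsLeadingSingularFunctions j M A Φ) : Orthonormal ℝ Φ := by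
  obtain ⟨q, hrq, s, U, V, -, -, hU, -, -, -, hΦ⟩ := h
  rw [funext hΦ]
  exact hU.comp _ (Fin.castLE_injective hrq)

lemma IsLeadingSingularFunctions.mem {j : ι} {M : Submodule ℝ (L2one O)} {A : L2 O ι}
    {r : ℕ} {Φ : Fin r → L2one O} (h : IsLeadingSingularFunctions j M A Φ) (ρ : Fin r) :
    Φ ρ ∈ M := by
  obtain ⟨q, hrq, s, U, V, -, -, -, -, hM, -, hΦ⟩ := h
  rw [hΦ]
  exact hM _

/-- Accuracy of range estimation in the `j`-th variable, from bounds on the two biases and on the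
projected noise. -/
theorem IsLeadingSingularFunctions.norm_sub_proj_le {j : ι} {κ κ' : Type*} [Fintype κ]
    [Fintype κ'] {v : κ → L2one O} {w : κ' → L2 O (Others j)} {T : L2 O ι →ₗ[ℝ] ℝ} {r : ℕ}
    {Φh Φ : Fin r → L2one O} {Ψ : Fin r → L2 O (Others j)} {σ : Fin r → ℝ} {s₀ η ε : ℝ}
    {A : L2 O ι} {M : Submodule ℝ (L2one O)}
    (h : IsLeadingSingularFunctions j M (projBoth j v w T) Φh)
    (hΦ : Orthonormal ℝ Φ) (hΨ : Orthonormal ℝ Ψ) (hs₀ : 0 < s₀) (hσ : ∀ k, s₀ ≤ σ k)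
    (hA : A = ∑ k, σ k • tensorAt j (Φ k) (Ψ k))
    (hL : ‖A - projOthers j w A‖ ≤ s₀ / 2)
    (hM : ‖projOthers j w A - projBoth j v w (functional A)‖ ≤ η)
    (hE : opNormProj j v w (T - functional A) ≤ ε)
    {x : L2one O} (hx : x ∈ Submodule.span ℝ (Set.range Φ)) :
    ‖x - proj Φh x‖ ≤ 2 / s₀ * (η + 2 * ε) * ‖x‖ := by
  obtain ⟨q, hrq, s, U, V, hs, hs0, hU, hV, -, hB, hΦh⟩ := h
  let Q : L2one O →ₗ[ℝ] L2one O :=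
    { toFun := proj v
      map_add' := proj_add v
      map_smul' := proj_smul v }
  have hQ : ∀ g, Q (contractLin j (projOthers j w A) g)
      = contract j g (projBoth j v w (functional A)) := fun g =>
    (contract_projBoth_functional j v w A g).symm
  rw [funext hΦh]
  refine norm_sub_proj_range_le (TA := fun g => contract j g A)
    (B := fun g => contract j g (projBoth j v w T)) (TL := contractLin j (projOthers j w A))
    (Q := Q) hΦ hΨ hs₀ hσ ?_ ?_ ?_ ?_ hrq hs hs0 hU hV ?_
    ((opNormProj_nonneg _ _ _ _).trans hE) ?_ ((norm_nonneg _).trans hM) hx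
  · intro g
    rw [hA, contract_sum_tensorAt]
  · intro g
    rw [contractLin_apply, contract_projOthers]
    refine Submodule.sum_mem _ fun η _ => Submodule.smul_mem _ _ ?_
    rw [hA, contract_sum_tensorAt]
    exact Submodule.sum_mem _ fun k _ => Submodule.smul_mem _ _ (Submodule.subset_span ⟨k, rfl⟩)
  · intro g
    rw [contractLin_apply, ← contract_sub]
    exact (norm_contract_le j g _).trans (by gcongr)
  · intro g
    rw [hQ, contractLin_apply, ← contract_sub]
    exact (norm_contract_le j g _).trans (by gcongr)
  · intro g
    rw [hB, contract_sum_tensorAt]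
  · intro g
    rw [hQ, ← contract_sub, ← projBoth_sub]
    exact (norm_contract_projBoth_le j v w _ g).trans (by gcongr)

end RangeEstimate

/-! ### The projected noise -/

section Noise

/-- A nonrandom spanning family for the estimation space spanned by `v`: the projections of the
true singular functions `Φ`, followed by the basis `v` itself. -/
noncomputable def dictionary {H : Type*} [NormedAddCommGroup H] [InnerProductSpace ℝ H]
    {κ κ' : Type*} [Fintype κ'] (Φ : κ → H) (v : κ' → H) : κ ⊕ κ' → H :=
  Sum.elim (fun k => proj v (Φ k)) v

/-- The squared weights of the dictionary: `1` for the true directions, `δ²` for the others. -/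
def dictionaryWeight (κ κ' : Type*) (δ : ℝ) : κ ⊕ κ' → ℝ :=
  Sum.elim (fun _ => 1) (fun _ => δ ^ 2)

lemma dictionaryWeight_nonneg (κ κ' : Type*) (δ : ℝ) (a : κ ⊕ κ') :
    0 ≤ dictionaryWeight κ κ' δ a := by
  rcases a with a | a
  · exact zero_le_one
  · exact sq_nonneg δ

lemma sum_dictionaryWeight (κ κ' : Type*) [Fintype κ] [Fintype κ'] (δ : ℝ) :
    ∑ a, dictionaryWeight κ κ' δ a = Fintype.card κ + Fintype.card κ' * δ ^ 2 := by
  simp [dictionaryWeight]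

section

variable {H : Type*} [NormedAddCommGroup H] [InnerProductSpace ℝ H]
  {κ κ' : Type*} [Fintype κ']

lemma norm_dictionary_le {Φ : κ → H} {v : κ' → H} (hΦ : Orthonormal ℝ Φ) (hv : Orthonormal ℝ v)
    (a : κ ⊕ κ') : ‖dictionary Φ v a‖ ≤ 1 := by
  rcases a with a | a
  · exact (norm_proj_le hv _).trans (hΦ.1 a).le
  · exact (hv.1 a).le

variable [Fintype κ]

/-- The coefficients of the estimated singular functions `e` in the dictionary: those of their
projections onto the true range, and those of the remainders. -/
noncomputable def dictionaryCoeff (Φ : κ → H) (v : κ' → H) {ρ : Type*} (e : ρ → H) (k : ρ) :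
    κ ⊕ κ' → ℝ :=
  Sum.elim (fun i => inner ℝ (e k) (Φ i)) (fun μ => inner ℝ (e k - proj Φ (e k)) (v μ))

lemma sum_dictionaryCoeff_smul (Φ : κ → H) {v : κ' → H} (hv : Orthonormal ℝ v) {ρ : Type*}
    {e : ρ → H} (k : ρ) (hk : e k ∈ Submodule.span ℝ (Set.range v)) :
    ∑ a, dictionaryCoeff Φ v e k a • dictionary Φ v a = e k := by
  rw [Fintype.sum_sum_type]
  simp only [dictionaryCoeff, dictionary, Sum.elim_inl, Sum.elim_inr]
  have h1 : ∑ i, (inner ℝ (e k) (Φ i) : ℝ) • proj v (Φ i) = proj v (proj Φ (e k)) := by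
    let Q : H →ₗ[ℝ] H :=
      { toFun := proj v
        map_add' := proj_add v
        map_smul' := proj_smul v }
    change ∑ i, (inner ℝ (e k) (Φ i) : ℝ) • Q (Φ i) = Q (∑ i, (inner ℝ (e k) (Φ i) : ℝ) • Φ i)
    rw [map_sum]; simp_rw [map_smul]
  have h2 : ∑ μ, (inner ℝ (e k - proj Φ (e k)) (v μ) : ℝ) • v μ
      = proj v (e k - proj Φ (e k)) := rfl
  rw [h1, h2, ← proj_add, add_sub_cancel, proj_of_mem_span hv hk]

/-- The coefficient matrix is bounded once its columns are divided by the weights. -/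
lemma sum_sq_dictionaryCoeff_le {Φ : κ → H} {v : κ' → H} (hΦ : Orthonormal ℝ Φ)
    (hv : Orthonormal ℝ v) {ρ : Type*} [Fintype ρ] {e : ρ → H} (he : Orthonormal ℝ e) {δ : ℝ}
    (hδ : 0 ≤ δ) (h : ∀ y ∈ Submodule.span ℝ (Set.range e), ‖y - proj Φ y‖ ≤ δ * ‖y‖)
    (x : κ ⊕ κ' → ℝ) :
    ∑ k, (∑ a, dictionaryCoeff Φ v e k a * x a) ^ 2
      ≤ 2 * ∑ a, dictionaryWeight κ κ' δ a * x a ^ 2 := by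
  set X := ∑ i, x (Sum.inl i) • Φ i with hX
  set Y := ∑ μ, x (Sum.inr μ) • v μ with hY
  have hk : ∀ k, ∑ a, dictionaryCoeff Φ v e k a * x a
      = inner ℝ X (e k) + inner ℝ (Y - proj Φ Y) (e k) := by
    intro k
    rw [inner_sub_proj_left, real_inner_comm (e k) X, real_inner_comm _ Y, hX, hY, inner_sum,
      inner_sum, Fintype.sum_sum_type]
    simp [dictionaryCoeff, inner_smul_right, mul_comm]
  simp_rw [hk]
  have h1 : ∑ k, inner ℝ X (e k) ^ 2 ≤ ∑ i, x (Sum.inl i) ^ 2 := by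
    rw [← norm_sq_proj he, ← norm_sq_sum_orthonormal hΦ]
    gcongr
    exact norm_proj_le he X
  have h2 : ∑ k, inner ℝ (Y - proj Φ Y) (e k) ^ 2 ≤ δ ^ 2 * ∑ μ, x (Sum.inr μ) ^ 2 := by
    rw [← norm_sq_proj he, ← norm_sq_sum_orthonormal hv, ← mul_pow]
    gcongr
    exact norm_proj_sub_proj_le he hδ h Y
  calc _ ≤ ∑ k, 2 * (inner ℝ X (e k) ^ 2 + inner ℝ (Y - proj Φ Y) (e k) ^ 2) :=
        Finset.sum_le_sum fun k _ => add_sq_le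
    _ ≤ 2 * (∑ i, x (Sum.inl i) ^ 2 + δ ^ 2 * ∑ μ, x (Sum.inr μ) ^ 2) := by
        rw [← Finset.mul_sum, Finset.sum_add_distrib]
        gcongr
    _ = _ := by
        rw [Fintype.sum_sum_type]
        simp [dictionaryWeight, Finset.mul_sum]

end

variable {O : Set ℝ} {d : ℕ}

/-- Weighted energy of the noise functional `Z` on the products of dictionary elements. -/
noncomputable def noiseEnergy {r : Fin d → ℕ} {m : ℕ} (Φ : ∀ i, Fin (r i) → L2one O)
    (v : Fin m → L2one O) (δ : Fin d → ℝ) (Z : L2 O (Fin d) →ₗ[ℝ] ℝ) : ℝ :=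
  ∑ a : (∀ i, Fin (r i) ⊕ Fin m), (∏ i, dictionaryWeight (Fin (r i)) (Fin m) (δ i) (a i))
    * Z (pureTensor fun i => dictionary (Φ i) v (a i)) ^ 2

/-- The projected noise is controlled by a nonrandom quadratic form in the noise, even though the
projections depend on it. -/
theorem norm_sq_finalEstimate_le {r : Fin d → ℕ} {m : ℕ} {Φ Φh : ∀ i, Fin (r i) → L2one O}
    {v : Fin m → L2one O} {δ : Fin d → ℝ} (Z : L2 O (Fin d) →ₗ[ℝ] ℝ)
    (hΦ : ∀ i, Orthonormal ℝ (Φ i)) (hv : Orthonormal ℝ v) (hΦh : ∀ i, Orthonormal ℝ (Φh i))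
    (hmem : ∀ i k, Φh i k ∈ Submodule.span ℝ (Set.range v)) (hδ : ∀ i, 0 ≤ δ i)
    (h : ∀ i, ∀ y ∈ Submodule.span ℝ (Set.range (Φh i)), ‖y - proj (Φ i) y‖ ≤ δ i * ‖y‖) :
    ‖finalEstimate Z Φh‖ ^ 2 ≤ 2 ^ d * noiseEnergy Φ v δ Z := by
  have h1 : ‖finalEstimate Z Φh‖ ^ 2
      = ∑ ρ : (∀ i, Fin (r i)), Z (pureTensor fun i => Φh i (ρ i)) ^ 2 :=
    norm_sq_sum_orthonormal (orthonormal_pureTensor hΦh) _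
  have h2 : ∀ ρ : (∀ i, Fin (r i)), Z (pureTensor fun i => Φh i (ρ i))
      = ∑ a : (∀ i, Fin (r i) ⊕ Fin m), (∏ i, dictionaryCoeff (Φ i) v (Φh i) (ρ i) (a i))
        * Z (pureTensor fun i => dictionary (Φ i) v (a i)) := by
    intro ρ
    rw [show (fun i => Φh i (ρ i)) = fun i => ∑ a, dictionaryCoeff (Φ i) v (Φh i) (ρ i) a
      • dictionary (Φ i) v a from funext fun i =>
        (sum_dictionaryCoeff_smul (Φ i) hv (ρ i) (hmem i _)).symm, pureTensor_sum, map_sum]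
    simp_rw [map_smul, smul_eq_mul]
  rw [h1]
  simp_rw [h2]
  exact sum_sq_kronecker_le zero_le_two d
    (fun i => dictionaryCoeff (Φ i) v (Φh i))
    (fun i => dictionaryWeight (Fin (r i)) (Fin m) (δ i)) (fun i => dictionaryWeight_nonneg _ _ _)
    (fun i => sum_sq_dictionaryCoeff_le (hΦ i) hv (hΦh i) (hδ i) (h i)) _

lemma noiseEnergy_nonneg {r : Fin d → ℕ} {m : ℕ} (Φ : ∀ i, Fin (r i) → L2one O)
    (v : Fin m → L2one O) (δ : Fin d → ℝ) (Z : L2 O (Fin d) →ₗ[ℝ] ℝ) :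
    0 ≤ noiseEnergy Φ v δ Z :=
  Finset.sum_nonneg fun _ _ => mul_nonneg
    (Finset.prod_nonneg fun _ _ => dictionaryWeight_nonneg _ _ _ _) (sq_nonneg _)

variable {Ω : Type*} [MeasurableSpace Ω] {P : Measure Ω}
  {T : Ω → L2 O (Fin d) →ₗ[ℝ] ℝ} {A : L2 O (Fin d)} {b : ℝ}

lemma IsUnbiasedWithVariance.integral_sq_le (hT : IsUnbiasedWithVariance P T A b)
    {G : L2 O (Fin d)} (hG : ‖G‖ ≤ 1) : ∫ ω, (T ω - functional A) G ^ 2 ∂P ≤ b := by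
  have h := hT.2.2 G hG
  rw [variance_eq_integral (hT.1 G).aestronglyMeasurable.aemeasurable, hT.2.1 G] at h
  exact h

variable [IsProbabilityMeasure P]

lemma IsUnbiasedWithVariance.integrable_sq (hT : IsUnbiasedWithVariance P T A b)
    (G : L2 O (Fin d)) : Integrable (fun ω => (T ω - functional A) G ^ 2) P :=
  ((hT.1 G).sub (memLp_const (functional A G))).integrable_sq

lemma IsUnbiasedWithVariance.integrable_noiseEnergy (hT : IsUnbiasedWithVariance P T A b)
    {r : Fin d → ℕ} {m : ℕ} (Φ : ∀ i, Fin (r i) → L2one O) (v : Fin m → L2one O)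
    (δ : Fin d → ℝ) : Integrable (fun ω => noiseEnergy Φ v δ (T ω - functional A)) P :=
  integrable_finsetSum _ fun _ _ => (hT.integrable_sq _).const_mul _

theorem IsUnbiasedWithVariance.integral_noiseEnergy_le (hT : IsUnbiasedWithVariance P T A b)
    {r : Fin d → ℕ} {m : ℕ} {Φ : ∀ i, Fin (r i) → L2one O} {v : Fin m → L2one O}
    (hΦ : ∀ i, Orthonormal ℝ (Φ i)) (hv : Orthonormal ℝ v) (δ : Fin d → ℝ) :
    ∫ ω, noiseEnergy Φ v δ (T ω - functional A) ∂P ≤ b * ∏ i, ((r i : ℝ) + m * δ i ^ 2) := by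
  unfold noiseEnergy
  rw [integral_finsetSum _ fun a _ => (hT.integrable_sq _).const_mul _]
  calc _ ≤ ∑ a : (∀ i, Fin (r i) ⊕ Fin m),
        (∏ i, dictionaryWeight (Fin (r i)) (Fin m) (δ i) (a i)) * b := by
        refine Finset.sum_le_sum fun a _ => ?_
        rw [integral_const_mul]
        refine mul_le_mul_of_nonneg_left (hT.integral_sq_le ?_)
          (Finset.prod_nonneg fun i _ => dictionaryWeight_nonneg _ _ _ _)
        rw [norm_pureTensor]
        exact Finset.prod_le_one (fun _ _ => norm_nonneg _)
          fun i _ => norm_dictionary_le (hΦ i) hv _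
    _ = _ := by
        rw [← Finset.sum_mul, mul_comm]
        congr 1
        have := Finset.prod_univ_sum (fun i => (Finset.univ : Finset (Fin (r i) ⊕ Fin m)))
          (fun i a => dictionaryWeight (Fin (r i)) (Fin m) (δ i) a)
        rw [Fintype.piFinset_univ] at this
        rw [← this]
        simp_rw [sum_dictionaryWeight, Fintype.card_fin]

end Noise

/-! ### Rates -/

section Rates

/-- Squared accuracy of range estimation in one variable, up to a constant: here `s` is the smallest
singular value, `n` the sample size. -/
noncomputable def rangeRate (d : ℕ) (α n s : ℝ) : ℝ :=
  s ^ (-2 : ℝ) / n ^ (2 * α / (2 * α + 1)) + s ^ (-((d : ℝ) - 1) / α - 2) / n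

lemma rangeRate_nonneg (d : ℕ) (α : ℝ) {n s : ℝ} (hn : 0 ≤ n) (hs : 0 ≤ s) :
    0 ≤ rangeRate d α n s := by
  unfold rangeRate; positivity

lemma sq_le_mul_rangeRate {d : ℕ} (hd : 1 ≤ d) {α : ℝ} (hα : 1 ≤ α) {K c₁ c₂ C' κ n s m l : ℝ}
    (hK : 0 < K) (hc₁ : 0 < c₁) (hn : 0 < n) (hs : 0 < s) (hl : 0 ≤ l)
    (hm1 : c₁ * n ^ (1 / (2 * α + 1)) ≤ m) (hm2 : m ≤ c₂ * n ^ (1 / (2 * α + 1)))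
    (hl2 : l ≤ C' * s ^ (-1 / α)) :
    (2 / s * (√(K * m ^ (-2 * α)) + 2 * (κ * √((m + l ^ (d - 1)) / n)))) ^ 2
      ≤ 8 * (K * c₁ ^ (-2 * α) + 4 * κ ^ 2 * (|c₂| + |C'| ^ (d - 1))) * rangeRate d α n s := by
  have hα0 : 0 < α := by linarith
  have hM : 0 < n ^ (1 / (2 * α + 1)) := Real.rpow_pos_of_pos hn _
  have hm0 : 0 < m := (by positivity : 0 < c₁ * n ^ (1 / (2 * α + 1))).trans_le hm1
  set p := n ^ (2 * α / (2 * α + 1)) with hp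
  have hp0 : 0 < p := Real.rpow_pos_of_pos hn _
  have hη : K * m ^ (-2 * α) ≤ K * c₁ ^ (-2 * α) / p := by
    have h1 : m ^ (-2 * α) ≤ (c₁ * n ^ (1 / (2 * α + 1))) ^ (-2 * α) :=
      Real.rpow_le_rpow_of_nonpos (by positivity) hm1 (by linarith)
    rw [Real.mul_rpow hc₁.le hM.le, ← Real.rpow_mul hn.le,
      show 1 / (2 * α + 1) * (-2 * α) = -(2 * α / (2 * α + 1)) by ring, Real.rpow_neg hn.le,
      ← hp] at h1
    calc K * m ^ (-2 * α) ≤ K * (c₁ ^ (-2 * α) * p⁻¹) := by gcongr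
      _ = _ := by ring
  have hmn : m / n ≤ |c₂| / p := by
    rw [div_le_div_iff₀ hn hp0]
    have hnp : n ^ (1 / (2 * α + 1)) * p = n := by
      rw [hp, ← Real.rpow_add hn, ← add_div, add_comm 1, div_self (by positivity), Real.rpow_one]
    calc m * p ≤ (c₂ * n ^ (1 / (2 * α + 1))) * p := by gcongr
      _ = c₂ * n := by rw [mul_assoc, hnp]
      _ ≤ |c₂| * n := by gcongr; exact le_abs_self _
  have hln : l ^ (d - 1) ≤ |C'| ^ (d - 1) * s ^ (-((d : ℝ) - 1) / α) := by
    calc l ^ (d - 1) ≤ (|C'| * s ^ (-1 / α)) ^ (d - 1) := by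
          gcongr
          exact hl2.trans (by gcongr; exact le_abs_self _)
      _ = _ := by
          rw [mul_pow, ← Real.rpow_natCast (s ^ (-1 / α)), ← Real.rpow_mul hs.le]
          congr 2
          push_cast [Nat.cast_sub hd]
          ring
  have hsplit : s ^ (-((d : ℝ) - 1) / α - 2) = s ^ (-((d : ℝ) - 1) / α) / s ^ 2 := by
    rw [Real.rpow_sub hs]; norm_num
  have hs2 : s ^ (-2 : ℝ) = 1 / s ^ 2 := by
    rw [Real.rpow_neg hs.le]; norm_num
  have hx0 : 0 ≤ s ^ (-((d : ℝ) - 1) / α) := by positivity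
  set x := s ^ (-((d : ℝ) - 1) / α)
  have hr1 : √(K * m ^ (-2 * α)) ^ 2 = K * m ^ (-2 * α) := Real.sq_sqrt (by positivity)
  have hr2 : √((m + l ^ (d - 1)) / n) ^ 2 = (m + l ^ (d - 1)) / n :=
    Real.sq_sqrt (by positivity)
  rw [rangeRate, ← hp, hsplit, hs2]
  calc _ = 4 / s ^ 2 * (√(K * m ^ (-2 * α)) + 2 * (κ * √((m + l ^ (d - 1)) / n))) ^ 2 := by
        rw [mul_pow, div_pow]; norm_num
    _ ≤ 4 / s ^ 2 * (2 * (√(K * m ^ (-2 * α)) ^ 2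
          + (2 * (κ * √((m + l ^ (d - 1)) / n))) ^ 2)) := by gcongr; exact add_sq_le
    _ = 8 / s ^ 2 * (K * m ^ (-2 * α) + 4 * κ ^ 2 * (m / n + l ^ (d - 1) / n)) := by
        rw [mul_pow, mul_pow, hr1, hr2]; ring
    _ ≤ 8 / s ^ 2 * (K * c₁ ^ (-2 * α) / p + 4 * κ ^ 2 * (|c₂| / p + |C'| ^ (d - 1) * x / n)) := by
        gcongr
    _ = 8 * ((K * c₁ ^ (-2 * α) + 4 * κ ^ 2 * |c₂|) * (1 / s ^ 2 / p)
          + 4 * κ ^ 2 * |C'| ^ (d - 1) * (x / s ^ 2 / n)) := by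
        field_simp
        ring
    _ ≤ 8 * ((K * c₁ ^ (-2 * α) + 4 * κ ^ 2 * (|c₂| + |C'| ^ (d - 1))) * (1 / s ^ 2 / p)
          + (K * c₁ ^ (-2 * α) + 4 * κ ^ 2 * (|c₂| + |C'| ^ (d - 1))) * (x / s ^ 2 / n)) := by
        have hA : 0 ≤ K * c₁ ^ (-2 * α) := by positivity
        have hB : 0 ≤ 4 * κ ^ 2 * |c₂| := by positivity
        have hC : 0 ≤ 4 * κ ^ 2 * |C'| ^ (d - 1) := by positivity
        refine mul_le_mul_of_nonneg_left (add_le_add ?_ ?_) (by norm_num) <;>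
          exact mul_le_mul_of_nonneg_right (by linarith) (by positivity)
    _ = _ := by ring

/-- Under the signal-to-noise condition, the total noise `m δ²` of the directions that are
estimated with accuracy `δ` is bounded. -/
lemma mul_rangeRate_le {d : ℕ} {α : ℝ} (hα : 1 ≤ α) {n s : ℝ} (hn : 0 < n) (hs : 0 < s)
    (h1 : 1 / s ^ (((d : ℝ) - 1) / α + 2) ≤ n ^ (2 * α / (2 * α + 1)))
    (h2 : 1 / s ^ (2 * α / (α - 1 / 2)) ≤ n ^ (2 * α / (2 * α + 1))) :
    n ^ (1 / (2 * α + 1)) * rangeRate d α n s ≤ 2 := by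
  have hM : 0 < n ^ (1 / (2 * α + 1)) := Real.rpow_pos_of_pos hn _
  set M := n ^ (1 / (2 * α + 1)) with hMdef
  have hα0 : 0 < α := by linarith
  have hp : n ^ (2 * α / (2 * α + 1)) = M ^ (2 * α) := by
    rw [hMdef, ← Real.rpow_mul hn.le]; congr 1; ring
  have hnM : n = M ^ (2 * α) * M := by
    rw [← hp, hMdef, ← Real.rpow_add hn, ← add_div, div_self (by positivity), Real.rpow_one]
  rw [hp] at h1 h2
  have hP : 0 < M ^ (2 * α) := Real.rpow_pos_of_pos hM _
  have e1 : M * (s ^ (-2 : ℝ) / M ^ (2 * α)) ≤ 1 := by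
    have h3 : s ^ (-2 : ℝ) ≤ M ^ (2 * α - 1) := by
      have h4 : (1 / s ^ (2 * α / (α - 1 / 2))) ^ ((2 * α - 1) / (2 * α))
          ≤ (M ^ (2 * α)) ^ ((2 * α - 1) / (2 * α)) := by
        refine Real.rpow_le_rpow (by positivity) h2 ?_
        exact div_nonneg (by linarith) (by linarith)
      have hne : 2 * α - 1 ≠ 0 := by linarith
      have hne' : α - 1 / 2 ≠ 0 := by linarith
      rw [one_div, ← Real.rpow_neg hs.le, ← Real.rpow_mul hs.le, ← Real.rpow_mul hM.le,
        mul_div_cancel₀ _ (by positivity)] at h4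
      convert h4 using 2
      field_simp
    rw [mul_div_assoc', div_le_one hP]
    calc M * s ^ (-2 : ℝ) ≤ M * M ^ (2 * α - 1) := by gcongr
      _ = M ^ (2 * α) := by
        rw [Real.rpow_sub hM, Real.rpow_one, mul_div_cancel₀ _ hM.ne']
  have e2 : M * (s ^ (-((d : ℝ) - 1) / α - 2) / n) ≤ 1 := by
    rw [mul_div_assoc', div_le_one hn]
    have h3 : s ^ (-((d : ℝ) - 1) / α - 2) = 1 / s ^ (((d : ℝ) - 1) / α + 2) := by
      rw [one_div, ← Real.rpow_neg hs.le]; congr 1; ring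
    calc M * s ^ (-((d : ℝ) - 1) / α - 2) ≤ M * M ^ (2 * α) := by rw [h3]; gcongr
      _ = n := by rw [hnM]; ring
  rw [rangeRate, hp, mul_add]
  linarith

lemma prod_add_le {d : ℕ} {r x : Fin d → ℝ} {C : ℝ} (hC : 0 ≤ C) (hr : ∀ i, 1 ≤ r i)
    (hx0 : ∀ i, 0 ≤ x i) (hx : ∀ i, x i ≤ C) :
    ∏ i, (r i + x i) ≤ (1 + C) ^ d * ∏ i, r i := by
  calc ∏ i, (r i + x i) ≤ ∏ i, ((1 + C) * r i) := by
        refine Finset.prod_le_prod (fun i _ => ?_) fun i _ => ?_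
        · linarith [hr i, hx0 i]
        · nlinarith [hr i, hx i]
    _ = _ := by rw [Finset.prod_mul_distrib]; simp

end Rates

/-! ### The error for a fixed realization of the noise -/

section Error

variable {O : Set ℝ} {d : ℕ}

/-- Error of the final estimate for a fixed realization of the noise: a quadratic form in the noise
and the approximation error of the estimated ranges. -/
theorem norm_sq_finalEstimate_sub_le {A : L2 O (Fin d)} {T : L2 O (Fin d) →ₗ[ℝ] ℝ}
    {φ : ℕ → L2one O} (hφ : Orthonormal ℝ φ) {m : ℕ} {l r : Fin d → ℕ}
    {Φ Φh : ∀ j, Fin (r j) → L2one O} {Ψ : ∀ j, Fin (r j) → L2 O (Others j)}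
    {σ : ∀ j, Fin (r j) → ℝ} {s ε : Fin d → ℝ} {η : ℝ}
    (hΦ : ∀ j, Orthonormal ℝ (Φ j)) (hΨ : ∀ j, Orthonormal ℝ (Ψ j)) (hs : ∀ j, 0 < s j)
    (hσ : ∀ j k, s j ≤ σ j k) (hA : ∀ j, A = ∑ k, σ j k • tensorAt j (Φ j k) (Ψ j k))
    (hL : ∀ j, ‖A - projOthers j (sketchBasis φ j (l j)) A‖ ≤ s j / 2)
    (hM : ∀ j, ‖projOthers j (sketchBasis φ j (l j)) A -
      projBoth j (estBasis φ m) (sketchBasis φ j (l j)) (functional A)‖ ≤ η)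
    (hE : ∀ j, opNormProj j (estBasis φ m) (sketchBasis φ j (l j)) (T - functional A) ≤ ε j)
    (hR : ∀ j, IsRangeEstimate T φ m (l j) j (Φh j)) :
    ‖finalEstimate T Φh - A‖ ^ 2
      ≤ 2 ^ (d + 1) * noiseEnergy Φ (estBasis φ m) (fun j => 2 / s j * (η + 2 * ε j))
          (T - functional A)
        + 2 * d * ‖A‖ ^ 2 * ∑ j, (2 / s j * (η + 2 * ε j)) ^ 2 := by
  set δ : Fin d → ℝ := fun j => 2 / s j * (η + 2 * ε j) with hδ
  have hδ0 : ∀ j, 0 ≤ δ j := fun j => mul_nonneg (div_nonneg zero_le_two (hs j).le)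
    (add_nonneg ((norm_nonneg _).trans (hM j))
      (mul_nonneg zero_le_two ((opNormProj_nonneg _ _ _ _).trans (hE j))))
  have hv : Orthonormal ℝ (estBasis φ m) := hφ.comp _ Fin.val_injective
  have hΦh : ∀ j, Orthonormal ℝ (Φh j) := fun j =>
    IsLeadingSingularFunctions.orthonormal (hR j)
  have hmem : ∀ j k, Φh j k ∈ Submodule.span ℝ (Set.range (estBasis φ m)) := fun j k =>
    IsLeadingSingularFunctions.mem (hR j) k
  have hclose : ∀ j, ∀ x ∈ Submodule.span ℝ (Set.range (Φ j)),
      ‖x - proj (Φh j) x‖ ≤ δ j * ‖x‖ := fun j x hx =>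
    IsLeadingSingularFunctions.norm_sub_proj_le (hR j) (hΦ j) (hΨ j) (hs j) (hσ j) (hA j) (hL j)
      (hM j) (hE j) hx
  have h1 := norm_sq_finalEstimate_le (T - functional A) hΦ hv hΦh hmem hδ0 fun j y hy =>
    norm_sub_proj_le_of_swap (hΦ j) (hΦh j) (hδ0 j) (hclose j) hy
  have h2 : ‖A - finalEstimate (functional A) Φh‖ ≤ ∑ j, δ j * ‖A‖ :=
    (norm_sub_finalEstimate_functional_le hΦh A).trans <| Finset.sum_le_sum fun j _ =>
      norm_sub_modeProj_le j (hΦ j) (hΨ j) (hA j) (Φh j) (hδ0 j) fun k => by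
        have := hclose j (Φ j k) (Submodule.subset_span ⟨k, rfl⟩)
        rwa [(hΦ j).1 k, mul_one] at this
  have h3 : ‖A - finalEstimate (functional A) Φh‖ ^ 2 ≤ d * ‖A‖ ^ 2 * ∑ j, δ j ^ 2 := by
    calc _ ≤ (∑ j, δ j * ‖A‖) ^ 2 := by gcongr
      _ ≤ d * ∑ j, (δ j * ‖A‖) ^ 2 := by
          simpa using sq_sum_le_card_mul_sum_sq (s := Finset.univ) (f := fun j => δ j * ‖A‖)
      _ = _ := by simp_rw [mul_pow]; rw [← Finset.sum_mul]; ring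
  have hsplit : finalEstimate T Φh - A
      = finalEstimate (T - functional A) Φh - (A - finalEstimate (functional A) Φh) := by
    have : finalEstimate (T - functional A) Φh
        = finalEstimate T Φh - finalEstimate (functional A) Φh := by
      simp [finalEstimate, sub_smul, Finset.sum_sub_distrib]
    rw [this]; abel
  rw [hsplit]
  calc _ ≤ (‖finalEstimate (T - functional A) Φh‖
        + ‖A - finalEstimate (functional A) Φh‖) ^ 2 := by gcongr; exact norm_sub_le _ _
    _ ≤ 2 * (‖finalEstimate (T - functional A) Φh‖ ^ 2
        + ‖A - finalEstimate (functional A) Φh‖ ^ 2) := add_sq_le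
    _ ≤ 2 * (2 ^ d * noiseEnergy Φ (estBasis φ m) δ (T - functional A)
        + d * ‖A‖ ^ 2 * ∑ j, δ j ^ 2) := by gcongr
    _ = _ := by ring

end Error

/-! ### The sketching bias, the signal-to-noise condition and Markov's inequality -/

section Thresholds

/-- With `l ≥ (4 K) ^ (1 / (2 α)) s ^ (-1 / α)`, the sketching bias is at most half of `s`. -/
lemma sketch_bias_le {α K CL s l b : ℝ} (hα : 1 ≤ α) (hK : 0 < K) (hs : 0 < s)
    (hCL : (4 * K) ^ (1 / (2 * α)) ≤ CL) (hl : CL * s ^ (-1 / α) ≤ l)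
    (hb : b ^ 2 ≤ K * l ^ (-2 * α)) : b ≤ s / 2 := by
  have hα0 : 0 < α := by linarith
  have hpos : 0 < (4 * K) ^ (1 / (2 * α)) * s ^ (-1 / α) := by positivity
  have h1 : l ^ (-2 * α) ≤ ((4 * K) ^ (1 / (2 * α)) * s ^ (-1 / α)) ^ (-2 * α) := by
    refine Real.rpow_le_rpow_of_nonpos hpos ?_ (by linarith)
    exact (mul_le_mul_of_nonneg_right hCL (by positivity)).trans hl
  have h2 : ((4 * K) ^ (1 / (2 * α)) * s ^ (-1 / α)) ^ (-2 * α) = (4 * K)⁻¹ * s ^ 2 := by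
    rw [Real.mul_rpow (by positivity) (by positivity), ← Real.rpow_mul (by positivity),
      ← Real.rpow_mul hs.le, show 1 / (2 * α) * (-2 * α) = -1 by field_simp,
      show -1 / α * (-2 * α) = (2 : ℕ) by field_simp; norm_num, Real.rpow_natCast,
      Real.rpow_neg_one]
  refine le_of_sq_le_sq ?_ (by positivity)
  calc b ^ 2 ≤ K * ((4 * K)⁻¹ * s ^ 2) := hb.trans (by rw [← h2]; gcongr)
    _ = (s / 2) ^ 2 := by field_simp; norm_num

lemma one_div_rpow_le_iInf {ι : Type*} [Finite ι] [Nonempty ι] {s : ι → ℝ} (hs : ∀ j, 0 < s j)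
    {y : ℝ} (hy : 0 ≤ y) (j : ι) : 1 / s j ^ y ≤ 1 / (⨅ j, s j) ^ y := by
  have hpos : 0 < ⨅ j, s j := by
    obtain ⟨i, hi⟩ := exists_eq_ciInf_of_finite (f := s)
    rw [← hi]; exact hs i
  refine one_div_le_one_div_of_le (Real.rpow_pos_of_pos hpos _) ?_
  exact Real.rpow_le_rpow hpos.le (ciInf_le (Set.finite_range s).bddBelow j) hy

lemma measure_ge_le_of_integral_le {Ω : Type*} [MeasurableSpace Ω] {P : Measure Ω}
    [IsProbabilityMeasure P] {X : Ω → ℝ} (hX0 : ∀ ω, 0 ≤ X ω) (hX : Integrable X P) {a p : ℝ}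
    (ha : 0 < a) (h : ∫ ω, X ω ∂P ≤ p * a) : P {ω | a ≤ X ω} ≤ ENNReal.ofReal p := by
  have h1 := mul_meas_ge_le_integral_of_nonneg (ae_of_all _ hX0) hX a
  rw [ENNReal.le_ofReal_iff_toReal_le (measure_ne_top _ _)]
  · have : a * P.real {ω | a ≤ X ω} ≤ a * p := by linarith
    exact le_of_mul_le_mul_left this ha
  · have : 0 ≤ p * a := (integral_nonneg hX0).trans h
    exact nonneg_of_mul_nonneg_left this ha

end Thresholds

/-! ### The rate in probability -/

section Probability

/-- The error bound for one sample size: outside the events that the projected noise is large in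
some variable, the rate holds with probability `1 - q`. -/
theorem measure_error_ge_le {d : ℕ} (hd : 1 ≤ d) {α : ℝ} (hα : 1 ≤ α) {Kbias : ℝ}
    (hKbias : 0 < Kbias) {O : Set ℝ} {Ω : Type*} [MeasurableSpace Ω] {P : Measure Ω}
    [IsProbabilityMeasure P] {A : L2 O (Fin d)} {Ahat : Ω → L2 O (Fin d) →ₗ[ℝ] ℝ} {r : Fin d → ℕ}
    {σ : Fin d → ℕ → ℝ} {φ : ℕ → L2one O} {m : ℕ} {l : Fin d → ℕ}
    {Φh : Ω → ∀ j : Fin d, Fin (r j) → L2one O} {CL CL' KA Kv c₁ c₂ n B t q : ℝ} {κ : Fin d → ℝ}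
    (hCL : (4 * Kbias) ^ (1 / (2 * α)) ≤ CL) (hc₁ : 0 < c₁) (hn : 0 < n)
    (hB : ∀ j, 8 * (Kbias * c₁ ^ (-2 * α) + 4 * κ j ^ 2 * (|c₂| + |CL'| ^ (d - 1))) ≤ B)
    (ht0 : 0 < t) (ht : (|Kv| + 1) * (1 + 2 * |c₂| * B) ^ d ≤ q * t)
    (hφ : Orthonormal ℝ φ) (hsvd : ∀ j, HasModeSVD j A (r j) (σ j)) (hKA : ‖A‖ ≤ KA)
    (hKv : IsUnbiasedWithVariance P Ahat A (Kv / n))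
    (hbias : ∀ j, BiasBounds Kbias α φ m (l j) j A)
    (hsnr : 1 * max (∏ j, (r j : ℝ))
          (max (1 / (⨅ j, σ j (r j)) ^ (((d : ℝ) - 1) / α + 2))
            (1 / (⨅ j, σ j (r j)) ^ (2 * α / (α - 1 / 2))))
          < n ^ (2 * α / (2 * α + 1)))
    (hl : ∀ j, CL * σ j (r j) ^ (-1 / α) ≤ (l j : ℝ) ∧ (l j : ℝ) ≤ CL' * σ j (r j) ^ (-1 / α))
    (hm : c₁ * n ^ (1 / (2 * α + 1)) ≤ (m : ℝ) ∧ (m : ℝ) ≤ c₂ * n ^ (1 / (2 * α + 1)))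
    (hrange : ∀ᵐ ω ∂P, ∀ j, IsRangeEstimate (Ahat ω) φ m (l j) j (Φh ω j)) :
    P {ω | (2 ^ (d + 1) * t + 2 * d * KA ^ 2 * B) *
        ((∑ j, σ j (r j) ^ (-2 : ℝ)) / n ^ (2 * α / (2 * α + 1))
          + (∑ j, σ j (r j) ^ (-((d : ℝ) - 1) / α - 2)) / n + (∏ j, (r j : ℝ)) / n)
        ≤ |‖finalEstimate (Ahat ω) (Φh ω) - A‖ ^ 2|}
      ≤ ∑ j, P {ω | κ j * √(((m : ℝ) + (l j : ℝ) ^ (d - 1)) / n) ≤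
          |opNormProj j (estBasis φ m) (sketchBasis φ j (l j)) (Ahat ω - functional A)|}
        + ENNReal.ofReal q := by
  have hα0 : 0 < α := by linarith
  have : Nonempty (Fin d) := ⟨⟨0, hd⟩⟩
  have hB0 : 0 ≤ B := le_trans (by positivity) (hB ⟨0, hd⟩)
  have hC0 : 0 ≤ 2 * |c₂| * B := by positivity
  choose hr1 hσpos hσanti Φ Ψ hΦ hΨ hA using hsvd
  set s : Fin d → ℝ := fun j => σ j (r j) with hs
  have hs0 : ∀ j, 0 < s j := fun j => hσpos j _ (hr1 j) le_rfl
  have hσs : ∀ j (k : Fin (r j)), s j ≤ σ j (k + 1) := fun j k =>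
    hσanti j _ _ (by omega) k.2 le_rfl
  have hr1' : ∀ j, (1 : ℝ) ≤ r j := fun j => by exact_mod_cast hr1 j
  have hprod : 0 < ∏ j, (r j : ℝ) := Finset.prod_pos fun j _ => zero_lt_one.trans_le (hr1' j)
  set p := n ^ (2 * α / (2 * α + 1)) with hp
  have hd1 : (1 : ℝ) ≤ d := by exact_mod_cast hd
  have hrate : ∀ j, n ^ (1 / (2 * α + 1)) * rangeRate d α n (s j) ≤ 2 := by
    intro j
    rw [one_mul, max_lt_iff, max_lt_iff] at hsnr
    refine mul_rangeRate_le hα hn (hs0 j) ?_ ?_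
    · exact (one_div_rpow_le_iInf hs0
        (add_nonneg (div_nonneg (by linarith) hα0.le) zero_le_two) j).trans hsnr.2.1.le
    · exact (one_div_rpow_le_iInf hs0
        (div_nonneg (by linarith) (by linarith)) j).trans hsnr.2.2.le
  set b : Fin d → ℝ := fun j => κ j * √(((m : ℝ) + (l j : ℝ) ^ (d - 1)) / n) with hb
  set η := √(Kbias * (m : ℝ) ^ (-2 * α)) with hη
  set δ : Fin d → ℝ := fun j => 2 / s j * (η + 2 * b j) with hδ
  have hδD : ∀ j, δ j ^ 2 ≤ B * rangeRate d α n (s j) := fun j =>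
    (sq_le_mul_rangeRate hd hα hKbias hc₁ hn (hs0 j) (Nat.cast_nonneg _) hm.1 hm.2
      (hl j).2).trans (mul_le_mul_of_nonneg_right (hB j) (rangeRate_nonneg d α hn.le (hs0 j).le))
  have hmδ : ∀ j, (m : ℝ) * δ j ^ 2 ≤ 2 * |c₂| * B := by
    intro j
    have h0 := rangeRate_nonneg d α hn.le (hs0 j).le
    calc (m : ℝ) * δ j ^ 2 ≤ (|c₂| * n ^ (1 / (2 * α + 1))) * (B * rangeRate d α n (s j)) := by
          gcongr
          · exact hm.2.trans (by gcongr; exact le_abs_self _)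
          · exact hδD j
      _ = |c₂| * B * (n ^ (1 / (2 * α + 1)) * rangeRate d α n (s j)) := by ring
      _ ≤ |c₂| * B * 2 := by gcongr; exact hrate j
      _ = 2 * |c₂| * B := by ring
  set E : Ω → ℝ := fun ω =>
    noiseEnergy Φ (estBasis φ m) δ (Ahat ω - functional (A)) with hE
  have hv : Orthonormal ℝ (estBasis φ m) := hφ.comp _ Fin.val_injective
  -- Markov's inequality for the noise energy
  have hmarkov : P {ω | t * ((∏ j, (r j : ℝ)) / n) ≤ E ω} ≤ ENNReal.ofReal q := by
    refine measure_ge_le_of_integral_le (fun ω => noiseEnergy_nonneg _ _ _ _)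
      (hKv.integrable_noiseEnergy Φ _ δ) (by positivity) ?_
    refine (hKv.integral_noiseEnergy_le hΦ hv δ).trans ?_
    have hle : ∏ i, ((r i : ℝ) + m * δ i ^ 2) ≤ (1 + 2 * |c₂| * B) ^ d * ∏ i, (r i : ℝ) :=
      prod_add_le hC0 hr1' (fun i => by positivity) hmδ
    calc Kv / n * ∏ i, ((r i : ℝ) + m * δ i ^ 2)
        ≤ (|Kv| + 1) / n * ((1 + 2 * |c₂| * B) ^ d * ∏ i, (r i : ℝ)) := by
          gcongr
          linarith [le_abs_self Kv]
      _ = ((|Kv| + 1) * (1 + 2 * |c₂| * B) ^ d) * ((∏ i, (r i : ℝ)) / n) := by ring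
      _ ≤ (q * t) * ((∏ i, (r i : ℝ)) / n) := by gcongr
      _ = q * (t * ((∏ j, (r j : ℝ)) / n)) := by ring
  have htarget : (∑ j, s j ^ (-2 : ℝ)) / p + (∑ j, s j ^ (-((d : ℝ) - 1) / α - 2)) / n
      + (∏ j, (r j : ℝ)) / n = ∑ j, rangeRate d α n (s j) + (∏ j, (r j : ℝ)) / n := by
    simp only [rangeRate, Finset.sum_add_distrib, Finset.sum_div, hp]
  have hsub : {ω | (2 ^ (d + 1) * t + 2 * d * KA ^ 2 * B) * ((∑ j, s j ^ (-2 : ℝ)) / p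
        + (∑ j, s j ^ (-((d : ℝ) - 1) / α - 2)) / n + (∏ j, (r j : ℝ)) / n)
        ≤ |‖finalEstimate (Ahat ω) (Φh ω) - A‖ ^ 2|}
      ⊆ ((⋃ j, {ω | b j ≤ |opNormProj j (estBasis φ m)
          (sketchBasis φ j (l j)) (Ahat ω - functional (A))|})
        ∪ {ω | ¬ ∀ j, IsRangeEstimate (Ahat ω) φ m (l j) j (Φh ω j)})
        ∪ {ω | t * ((∏ j, (r j : ℝ)) / n) ≤ E ω} := by
    intro ω hω
    by_contra hcon
    simp only [Set.mem_union, Set.mem_iUnion, Set.mem_ofPred_eq, not_or, not_exists, not_le,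
      not_not] at hcon
    obtain ⟨⟨hop, hR⟩, hEω⟩ := hcon
    have hmain := norm_sq_finalEstimate_sub_le hφ hΦ hΨ hs0 hσs hA
      (fun j => sketch_bias_le hα hKbias (hs0 j) hCL (hl j).1 (hbias j).2.1)
      (fun j => Real.le_sqrt_of_sq_le (hbias j).2.2)
      (fun j => (le_abs_self _).trans (hop j).le) hR
    rw [Set.mem_ofPred_eq] at hω
    refine absurd hω (not_le.2 ?_)
    rw [htarget, abs_of_nonneg (sq_nonneg _)]
    have hD0 : 0 ≤ ∑ j, rangeRate d α n (s j) :=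
      Finset.sum_nonneg fun j _ => rangeRate_nonneg d α hn.le (hs0 j).le
    have hδsum : ∑ j, δ j ^ 2 ≤ B * ∑ j, rangeRate d α n (s j) := by
      rw [Finset.mul_sum]; exact Finset.sum_le_sum fun j _ => hδD j
    have hq : 0 < (∏ j, (r j : ℝ)) / n := by positivity
    calc ‖finalEstimate (Ahat ω) (Φh ω) - A‖ ^ 2
        ≤ 2 ^ (d + 1) * E ω + 2 * d * ‖A‖ ^ 2 * ∑ j, δ j ^ 2 := hmain
      _ < 2 ^ (d + 1) * (t * ((∏ j, (r j : ℝ)) / n))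
          + 2 * d * KA ^ 2 * (B * ∑ j, rangeRate d α n (s j)) := by
          refine add_lt_add_of_lt_of_le (by gcongr) (by gcongr)
      _ ≤ (2 ^ (d + 1) * t + 2 * d * KA ^ 2 * B)
          * (∑ j, rangeRate d α n (s j) + (∏ j, (r j : ℝ)) / n) := by
          have e1 : 0 ≤ 2 ^ (d + 1) * t * ∑ j, rangeRate d α n (s j) := by positivity
          have e2 : 0 ≤ 2 * d * KA ^ 2 * B * ((∏ j, (r j : ℝ)) / n) := by positivity
          linarith
  refine (measure_mono hsub).trans ((measure_union_le _ _).trans ?_)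
  refine add_le_add ((measure_union_le _ _).trans ?_) hmarkov
  rw [show P {ω | ¬ ∀ j, IsRangeEstimate (Ahat ω) φ m (l j) j (Φh ω j)} = 0 from ae_iff.1 hrange,
    add_zero]
  exact measure_iUnion_fintype_le _ _

end Probability

end VRS

theorem theorem4 (d : ℕ) (hd : 1 ≤ d) (α : ℝ) (hα : 1 ≤ α) (Kbias : ℝ) (hKbias : 0 < Kbias) :
    -- thresholds for "sufficiently large" constants: they depend on `d`, `α`, `Kbias` only
    ∃ CL₀ : ℝ, 0 < CL₀ ∧ ∃ Csnr : ℝ, 0 < Csnr ∧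
    ∀ (O : Set ℝ) (_ : MeasurableSet O)
      -- for each sample size `N`: a probability space, the target and its estimator
      (Ω : ℕ → Type*) [∀ N, MeasurableSpace (Ω N)] (P : ∀ N, Measure (Ω N))
      [∀ N, IsProbabilityMeasure (P N)]
      (A : ℕ → L2 O (Fin d)) (Ahat : ∀ N, Ω N → L2 O (Fin d) →ₗ[ℝ] ℝ)
      -- ranks and singular values (`σ N j ρ` for `1 ≤ ρ ≤ r N j`)
      (r : ℕ → Fin d → ℕ) (σ : ℕ → Fin d → ℕ → ℝ)
      -- orthonormal functions, dimensions of the estimation and sketching spaces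
      (φ : ℕ → ℕ → L2one O) (m : ℕ → ℕ) (l : ℕ → Fin d → ℕ)
      -- the singular functions computed by the algorithm
      (Φ : ∀ N, Ω N → ∀ j : Fin d, Fin (r N j) → L2one O)
      (CL CL' : ℝ) (_ : CL₀ ≤ CL),
      (∀ N, Orthonormal ℝ (φ N)) →
      -- finite multilinear ranks, bounded norm
      (∀ᶠ N in atTop, ∀ j, HasModeSVD j (A N) (r N j) (σ N j)) →
      (∃ KA : ℝ, ∀ᶠ N in atTop, ‖A N‖ ≤ KA) →
      -- weak unbiasedness, variance `O(1/N)`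
      (∃ Kv : ℝ, ∀ᶠ N in atTop, IsUnbiasedWithVariance (P N) (Ahat N) (A N) (Kv / N)) →
      -- bias of the pairs `(M_j, L_j)`
      (∀ᶠ N in atTop, ∀ j, BiasBounds Kbias α (φ N) (m N) (l N j) j (A N)) →
      -- deviation of the estimator within `M_j ⊗ L_j`
      (∀ j, IsBigOP P
        (fun N ω => opNormProj j (estBasis (φ N) (m N)) (sketchBasis (φ N) j (l N j))
          (Ahat N ω - functional (A N)))
        (fun N => √(((m N : ℝ) + (l N j : ℝ) ^ (d - 1)) / N))) →
      -- signal-to-noise condition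
      (∀ᶠ N in atTop,
        Csnr * max (∏ j, (r N j : ℝ))
          (max (1 / (⨅ j, σ N j (r N j)) ^ (((d : ℝ) - 1) / α + 2))
            (1 / (⨅ j, σ N j (r N j)) ^ (2 * α / (α - 1 / 2))))
          < (N : ℝ) ^ (2 * α / (2 * α + 1))) →
      -- `l_j = C_L σ_{j,r_j}^{-1/α}` up to rounding
      (∀ᶠ N in atTop, ∀ j, CL * σ N j (r N j) ^ (-1 / α) ≤ (l N j : ℝ) ∧
        (l N j : ℝ) ≤ CL' * σ N j (r N j) ^ (-1 / α)) →
      -- `m ≍ N^{1/(2α+1)}`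
      (∃ c₁ c₂ : ℝ, 0 < c₁ ∧ ∀ᶠ N : ℕ in atTop, c₁ * (N : ℝ) ^ (1 / (2 * α + 1)) ≤ (m N : ℝ) ∧
        (m N : ℝ) ≤ c₂ * (N : ℝ) ^ (1 / (2 * α + 1))) →
      -- `Φ` is an output of the range estimation step for each `j`
      (∀ᶠ N in atTop, ∀ᵐ ω ∂(P N), ∀ j,
        IsRangeEstimate (Ahat N ω) (φ N) (m N) (l N j) j (Φ N ω j)) →
      IsBigOP P (fun N ω => ‖finalEstimate (Ahat N ω) (Φ N ω) - A N‖ ^ 2)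
        (fun N => (∑ j, σ N j (r N j) ^ (-2 : ℝ)) / (N : ℝ) ^ (2 * α / (2 * α + 1))
          + (∑ j, σ N j (r N j) ^ (-((d : ℝ) - 1) / α - 2)) / N
          + (∏ j, (r N j : ℝ)) / N) := by
  -- `C_L` makes the sketching bias at most half of the smallest singular value; the signal-to-noise
  -- condition only serves to bound `m δ²`, for which any positive constant will do
  refine ⟨(4 * Kbias) ^ (1 / (2 * α)), by positivity, 1, one_pos, ?_⟩
  intro O _ Ω _ P _ A Ahat r σ φ m l Φh CL CL' hCL hφ hsvd ⟨KA, hKA⟩ ⟨Kv, hKv⟩ hbias hdev hsnr hl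
    ⟨c₁, c₂, hc₁, hm⟩ hrange ε hε
  have hd0 : (0 : ℝ) < d := by exact_mod_cast hd
  -- the noise events of the `d` variables together, and Markov's inequality, take `ε / 4` each
  have hdev' : ∀ j, ∃ κ : ℝ, 0 < κ ∧ ∀ᶠ N in atTop, P N {ω | κ * √(((m N : ℝ) +
      (l N j : ℝ) ^ (d - 1)) / N) ≤ |opNormProj j (estBasis (φ N) (m N))
        (sketchBasis (φ N) j (l N j)) (Ahat N ω - functional (A N))|}
      < ENNReal.ofReal (ε / (4 * d)) := fun j => by
    obtain ⟨κ, hκ, h⟩ := hdev j (ε / (4 * d)) (by positivity)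
    exact ⟨κ, hκ, eventually_lt_of_limsup_lt h⟩
  choose κ hκ0 hκ using hdev'
  set Bj : Fin d → ℝ := fun j =>
    8 * (Kbias * c₁ ^ (-2 * α) + 4 * κ j ^ 2 * (|c₂| + |CL'| ^ (d - 1))) with hBj
  have hBj0 : ∀ j, 0 ≤ Bj j := fun j => by positivity
  set B := ∑ j, Bj j with hB
  have hB0 : 0 ≤ B := Finset.sum_nonneg fun j _ => hBj0 j
  have hBle : ∀ j, Bj j ≤ B := fun j => Finset.single_le_sum (fun j _ => hBj0 j) (Finset.mem_univ j)
  -- the bound for `m δ²`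
  set C := 2 * |c₂| * B with hC
  have hC0 : 0 ≤ C := by positivity
  -- the threshold for the noise energy, in units of `(∏ r) / N`
  set t := 4 * (|Kv| + 1) * (1 + C) ^ d / ε with ht
  have ht0 : 0 < t := by positivity
  refine ⟨2 ^ (d + 1) * t + 2 * d * KA ^ 2 * B, by positivity, lt_of_le_of_lt
    (limsup_le_of_le (by isBoundedDefault) (a := ENNReal.ofReal (ε / 2)) ?_)
    ((ENNReal.ofReal_lt_ofReal_iff hε).2 (by linarith))⟩
  filter_upwards [hsvd, hKA, hKv, hbias, hsnr, hl, hm, hrange, eventually_all.2 hκ,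
    eventually_gt_atTop 0] with N hsvd hKA hKv hbias hsnr hl hm hrange hκ hN
  have hmain := measure_error_ge_le hd hα hKbias hCL hc₁ (Nat.cast_pos.2 hN) hBle ht0
    (q := ε / 4) (le_of_eq (by rw [ht, hC]; field_simp)) (hφ N) hsvd hKA hKv hbias hsnr hl hm hrange
  refine hmain.trans ?_
  have hsum : ∑ _j : Fin d, ENNReal.ofReal (ε / (4 * d)) = ENNReal.ofReal (ε / 4) := by
    rw [Finset.sum_const, Finset.card_univ, Fintype.card_fin, nsmul_eq_mul,
      ← ENNReal.ofReal_natCast, ← ENNReal.ofReal_mul (Nat.cast_nonneg _)]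
    congr 1
    field_simp
  calc _ ≤ ENNReal.ofReal (ε / 4) + ENNReal.ofReal (ε / 4) :=
        add_le_add ((Finset.sum_le_sum fun j _ => (hκ j).le).trans hsum.le) le_rfl
    _ = ENNReal.ofReal (ε / 2) := by
        rw [← ENNReal.ofReal_add (by positivity) (by positivity)]
        congr 1; ring
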